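/- For a prime power \(Q\) and a positive integer \(s\mid Q-1\), let \(\mathbf F=\mathrm{GF}(Q)\), let \(H\) be the subgroup of order \(s\) of \(\mathbf F^\ast\), and let \(G(Q,s)\) be the simple graph whose vertices are the classes \(\langle a,b\rangle\) of pairs \((a,b)\in\mathbf F^2\setminus\{(0,0)\}\), where \((a_1,b_1)\sim(a_2,b_2)\) iff \((a_1,b_1)=(ha_2,hb_2)\) for some \(h\in H\), and in which two distinct vertices \(\langle a,b\rangle\), \(\langle x,y\rangle\) are joined by an edge iff \(ax+by\in H\). Theorem. Let \(r\ge 2\) and \(t\ge 1\) be integers. (1) For every prime power \(q\) with \(t\mid q-1\), the graph \(G\bigl(q^{r-1},\,t(q^{r-2}+\cdots+q+1)\bigr)\) is \(K_{r,\,t^{r-1}(r-1)!+1}\)-free, i.e. it contains no (not necessarily induced) subgraph isomorphic to \(K_{r,\,t^{r-1}(r-1)!+1}\). (2) For fixed \(r\) and \(t\), as \(n\to\infty\) through all positive integers, \[ \mathrm{ex}\bigl(n, K_{r,\,t^{r-1}(r-1)!+1}\bigr)\ \ge\ \tfrac12\, t^{\frac{r-1}{r}}\, n^{2-\frac1r}\,(1+o(1)),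 \] where \(\mathrm{ex}(n,K)\) is the maximum number of edges of a simple graph on \(n\) vertices that contains no subgraph isomorphic to \(K\). -/

import Mathlib

open Filter Topology

namespace Furedi

/-- Nonzero pairs over `F`, identified when they differ by a common factor from `H`. -/
def pairSetoid {F : Type*} [Field F] (H : Subgroup Fˣ) : Setoid {p : F × F // p ≠ 0} where
  r p₁ p₂ := ∃ h ∈ H, p₁.1.1 = (h : F) * p₂.1.1 ∧ p₁.1.2 = (h : F) * p₂.1.2
  iseqv := by
    refine ⟨fun p => ⟨1, H.one_mem, by simp⟩, ?_, ?_⟩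
    · rintro p₁ p₂ ⟨h, hh, e₁, e₂⟩
      exact ⟨h⁻¹, H.inv_mem hh, by simp [e₁], by simp [e₂]⟩
    · rintro p₁ p₂ p₃ ⟨h, hh, e₁, e₂⟩ ⟨k, hk, f₁, f₂⟩
      exact ⟨h * k, H.mul_mem hh hk, by simp [e₁, f₁, mul_assoc], by simp [e₂, f₂, mul_assoc]⟩

/-- The vertex set: classes of nonzero pairs modulo multiplication by `H`. -/
def Vertex {F : Type*} [Field F] (H : Subgroup Fˣ) : Type _ :=
  Quotient (pairSetoid H)

/-- The element `a * x + b * y` of `F` lies in `H`. -/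
def PairRel {F : Type*} [Field F] (H : Subgroup Fˣ) (p s : {p : F × F // p ≠ 0}) : Prop :=
  ∃ h ∈ H, p.1.1 * s.1.1 + p.1.2 * s.1.2 = (h : F)

theorem PairRel.symm {F : Type*} [Field F] {H : Subgroup Fˣ} {p s : {p : F × F // p ≠ 0}}
    (h : PairRel H p s) : PairRel H s p := by
  obtain ⟨k, hk, e⟩ := h
  exact ⟨k, hk, by rw [← e]; ring⟩

theorem PairRel.congr_left {F : Type*} [Field F] {H : Subgroup Fˣ}
    {p p' s : {p : F × F // p ≠ 0}} (hp : pairSetoid H p p') (h : PairRel H p' s) :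
    PairRel H p s := by
  obtain ⟨k, hk, e₁, e₂⟩ := hp
  obtain ⟨m, hm, e⟩ := h
  refine ⟨k * m, H.mul_mem hk hm, ?_⟩
  rw [Units.val_mul, ← e, e₁, e₂]
  ring

theorem PairRel.congr {F : Type*} [Field F] {H : Subgroup Fˣ}
    {p s p' s' : {p : F × F // p ≠ 0}} (hp : pairSetoid H p p') (hs : pairSetoid H s s')
    (h : PairRel H p' s') : PairRel H p s :=
  PairRel.congr_left hp (PairRel.symm (PairRel.congr_left hs (PairRel.symm h)))

/-- `⟨a, b⟩` and `⟨x, y⟩` are related when `a * x + b * y ∈ H`, for any representatives. -/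
def VertexRel {F : Type*} [Field F] (H : Subgroup Fˣ) (u v : Vertex H) : Prop :=
  Quotient.liftOn₂ u v (PairRel H) fun _ _ _ _ hp hs =>
    propext ⟨PairRel.congr ((pairSetoid H).symm hp) ((pairSetoid H).symm hs),
      PairRel.congr hp hs⟩

/-- The simple graph on `Vertex H` in which distinct `⟨a, b⟩` and `⟨x, y⟩` are joined iff
`a * x + b * y ∈ H`. For `F = GF(Q)` and `H` the subgroup of order `s` of `Fˣ` this is `G(Q, s)`. -/
def graph {F : Type*} [Field F] (H : Subgroup Fˣ) : SimpleGraph (Vertex H) where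
  Adj u v := u ≠ v ∧ VertexRel H u v
  symm := ⟨by
    rintro u v ⟨hne, h⟩
    refine ⟨hne.symm, ?_⟩
    induction u using Quotient.inductionOn
    induction v using Quotient.inductionOn
    exact PairRel.symm h⟩
  loopless := ⟨fun _ h => h.1 rfl⟩

end Furedi

/-! Write Q = q^(r-1), and let N(x) = x^(1 + q + ⋯ + q^(r-2)), the norm from GF(Q) to GF(q).

Freeness. Take r inequivalent vertices with a common neighbour S. The ratios of the values of the r
linear forms at S lie in H, so their norms are t-th roots of unity. Any three vectors of a plane are
linearly related, so every ratio is affine in one of them, z. Hence z satisfies r - 1 equations N(z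
- d_i) = c_i with distinct d_i and at most t values for each c_i, and z determines S modulo H. In
the conjugates of z each equation reads ∏_j (x_j - a_ij) = b_i, so it remains to show that such a
system in m unknowns has at most m! solutions (`card_fiber_le`). The polynomial map with these
coordinates is finite, by a valuation argument. Its scheme-theoretic fibre over 0 has length at most
m!, since solving it means matching equations with coordinates. By Nakayama the generic degree is at
most m!. As the base ring is integrally closed, a linear form separating the points of a fibre has a
minimal polynomial of degree at most m!, and all its values on the fibre are roots of one
specialisation of that polynomial.

Lower bound. The graph has (Q² - 1)/|H| vertices, each of degree at least Q - 1, which gives the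
right order when q is close to (tn)^(1/r). To reach every n, prime powers q ≡ 1 mod t are needed in
[x/η, x] for each η > 1 and large x. This follows from a Wiener–Ikehara argument
(`exists_ne_zero_abs_log_sub_lt`): a gap would make a narrow Fejér average of the von Mangoldt
weights too small to match the pole at 1. -/

namespace Furedi

open MvPolynomial

/-! ### Spanning sets of quotient algebras. -/

section SpannedMod

variable {K A : Type*} [Field K] [CommRing A] [Algebra K A]

/-- Modulo the ideal `J`, the algebra `A` is spanned over `K` by at most `n` elements. -/
def SpannedMod (K : Type*) {A : Type*} [Field K] [CommRing A] [Algebra K A]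
    (J : Ideal A) (n : ℕ) : Prop :=
  ∃ s : Finset A, s.card ≤ n ∧ ∀ a : A, ∃ b ∈ Submodule.span K (s : Set A), a - b ∈ J

theorem SpannedMod.mono {J J' : Ideal A} {n n' : ℕ} (h : SpannedMod K J n) (hJ : J ≤ J')
    (hn : n ≤ n') : SpannedMod K J' n' := by
  obtain ⟨s, hs, h⟩ := h
  refine ⟨s, hs.trans hn, fun a => ?_⟩
  obtain ⟨b, hb, hab⟩ := h a
  exact ⟨b, hb, hJ hab⟩

theorem spannedMod_of_one_mem {J : Ideal A} (h : (1 : A) ∈ J) (n : ℕ) : SpannedMod K J n :=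
  ⟨∅, by simp, fun a => ⟨0, Submodule.zero_mem _, by
    rw [(Ideal.eq_top_iff_one J).2 h]; trivial⟩⟩

/-- Multiplication by v maps A/(J, u) onto the kernel of A/(J, uv) → A/(J, v), so the two spanning
sets combine. -/
theorem SpannedMod.mul {J : Ideal A} {u v : A} {k l : ℕ}
    (hu : SpannedMod K (J ⊔ Ideal.span {u}) k) (hv : SpannedMod K (J ⊔ Ideal.span {v}) l) :
    SpannedMod K (J ⊔ Ideal.span {u * v}) (k + l) := by
  classical
  obtain ⟨s, hs, hu⟩ := hu
  obtain ⟨t, ht, hv⟩ := hv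
  refine ⟨s.image (v * ·) ∪ t, ?_, fun a => ?_⟩
  · exact (Finset.card_union_le _ _).trans (add_le_add (Finset.card_image_le.trans hs) ht)
  · obtain ⟨b, hb, hab⟩ := hv a
    obtain ⟨j, hj, x, hx, e⟩ := Submodule.mem_sup.1 hab
    obtain ⟨c, rfl⟩ := Ideal.mem_span_singleton'.1 hx
    obtain ⟨b', hb', hcb⟩ := hu c
    obtain ⟨j', hj', x', hx', e'⟩ := Submodule.mem_sup.1 hcb
    obtain ⟨d, rfl⟩ := Ideal.mem_span_singleton'.1 hx'
    refine ⟨v * b' + b, Submodule.add_mem _ ?_ ?_, ?_⟩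
    · have : v * b' ∈ Submodule.map (LinearMap.mulLeft K v) (Submodule.span K (s : Set A)) :=
        ⟨b', hb', rfl⟩
      rw [Submodule.map_span] at this
      refine Submodule.span_mono ?_ this
      rintro _ ⟨y, hy, rfl⟩
      simp only [Finset.coe_union, Finset.coe_image]
      exact Or.inl ⟨y, hy, rfl⟩
    · exact Submodule.span_mono (by simp) hb
    · have : a - (v * b' + b) = (j + v * j') + d * (u * v) := by
        linear_combination -e - v * e'
      rw [this]
      exact Submodule.add_mem_sup (J.add_mem hj (J.mul_mem_left _ hj'))
        (Ideal.mul_mem_left _ _ (Ideal.mem_span_singleton_self _))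

theorem SpannedMod.prod {ι : Type*} {J : Ideal A} {u : ι → A} {n : ι → ℕ} (T : Finset ι)
    (h : ∀ j ∈ T, SpannedMod K (J ⊔ Ideal.span {u j}) (n j)) :
    SpannedMod K (J ⊔ Ideal.span {∏ j ∈ T, u j}) (∑ j ∈ T, n j) := by
  classical
  induction T using Finset.induction_on with
  | empty =>
    exact spannedMod_of_one_mem (Ideal.mem_sup_right (by simp)) _
  | insert i T hi ih =>
    rw [Finset.prod_insert hi, Finset.sum_insert hi]
    exact (h i (by simp)).mul (ih fun j hj => h j (by simp [hj]))

end SpannedMod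

/-! ### Products of linear forms: the zero fibre, and a valuation criterion. -/

section NormForms

variable {K σ : Type*} [Field K]

/-- The product of the linear forms `X j - a i j`. -/
noncomputable def normForm [Fintype σ] (a : σ → σ → K) (i : σ) : MvPolynomial σ K :=
  ∏ j, (X j - C (a i j))

theorem spannedMod_one_of_point {J : Ideal (MvPolynomial σ K)} (p : σ → K)
    (h : ∀ j, X j - C (p j) ∈ J) : SpannedMod K J 1 := by
  refine ⟨{1}, by simp, fun f => ⟨C (eval p f), ?_, ?_⟩⟩
  · rw [Finset.coe_singleton, Submodule.mem_span_singleton]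
    exact ⟨eval p f, by rw [Algebra.smul_def, mul_one]; rfl⟩
  · rw [← Ideal.Quotient.mk_eq_mk_iff_sub_mem]
    have : (Ideal.Quotient.mkₐ K J) = (Algebra.ofId K _).comp (aeval p) := by
      refine MvPolynomial.algHom_ext fun j => ?_
      simp only [Ideal.Quotient.mkₐ_eq_mk, AlgHom.comp_apply, aeval_X]
      exact (Ideal.Quotient.mk_eq_mk_iff_sub_mem _ _).2 (h j)
    have h2 := DFunLike.congr_fun this f
    rw [AlgHom.comp_apply] at h2
    exact h2

variable [Fintype σ]

/-- Here U holds the unused equations and D the free coordinates, the others being fixed at p. In an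
equation i ∈ U the factors outside D are units, so one of the n factors in D vanishes. This fixes
that coordinate at a value that no other equation can use, and leaves n - 1 of each: n · (n-1)! in
total. -/
theorem spannedMod_factorial [DecidableEq σ] {a : σ → σ → K}
    (ha : ∀ j, Function.Injective fun i => a i j) (n : ℕ) :
    ∀ (U D : Finset σ) (p : σ → K) (J : Ideal (MvPolynomial σ K)), U.card = n → D.card = n →
      (∀ i ∈ U, normForm a i ∈ J) → (∀ j ∉ D, X j - C (p j) ∈ J) →
      (∀ i ∈ U, ∀ j ∉ D, a i j ≠ p j) → SpannedMod K J n.factorial := by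
  induction n with
  | zero =>
    intro U D p J _ hD _ hp _
    rw [Finset.card_eq_zero] at hD
    subst hD
    exact spannedMod_one_of_point p fun j => hp j (by simp)
  | succ n ih =>
    intro U D p J hU hD hf hp hne
    obtain ⟨i, hi⟩ : U.Nonempty := Finset.card_pos.1 (by omega)
    have key : SpannedMod K (J ⊔ Ideal.span {∏ j, (X j - C (a i j))})
        (∑ j, if j ∈ D then n.factorial else 0) := by
      refine SpannedMod.prod _ fun j _ => ?_
      split_ifs with hj
      · refine ih (U.erase i) (D.erase j) (Function.update p j (a i j)) _
          (by rw [Finset.card_erase_of_mem hi, hU]; rfl)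
          (by rw [Finset.card_erase_of_mem hj, hD]; rfl)
          (fun i' hi' => Ideal.mem_sup_left (hf i' (Finset.mem_of_mem_erase hi'))) ?_ ?_
        · intro k hk
          rcases eq_or_ne k j with rfl | hkj
          · rw [Function.update_self]
            exact Ideal.mem_sup_right (Ideal.mem_span_singleton_self _)
          · rw [Function.update_of_ne hkj]
            exact Ideal.mem_sup_left (hp k fun h => hk (Finset.mem_erase.2 ⟨hkj, h⟩))
        · intro i' hi' k hk
          rcases eq_or_ne k j with rfl | hkj
          · rw [Function.update_self]
            exact fun h => Finset.ne_of_mem_erase hi' (ha k h)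
          · rw [Function.update_of_ne hkj]
            exact hne i' (Finset.mem_of_mem_erase hi') k
              fun h => hk (Finset.mem_erase.2 ⟨hkj, h⟩)
      -- The coordinate would equal both p j and a i j, which differ, so the ideal is the whole
      -- ring.
      · refine spannedMod_of_one_mem ?_ _
        have h1 : X j - C (p j) ∈ J ⊔ Ideal.span {X j - C (a i j)} := Ideal.mem_sup_left (hp j hj)
        have h2 : X j - C (a i j) ∈ J ⊔ Ideal.span {X j - C (a i j)} :=
          Ideal.mem_sup_right (Ideal.mem_span_singleton_self _)
        have h3 := Ideal.mul_mem_left _ (C (a i j - p j)⁻¹) (Ideal.sub_mem _ h1 h2)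
        have h4 : X j - C (p j) - (X j - C (a i j)) = C (σ := σ) (a i j - p j) := by
          rw [C_sub]; ring
        rwa [h4, ← C_mul, inv_mul_cancel₀ (sub_ne_zero.2 (hne i hi j hj)), C_1] at h3
    refine key.mono (sup_le le_rfl ?_) ?_
    · rw [Ideal.span_singleton_le_iff_mem]
      exact hf i hi
    · rw [Finset.sum_ite_mem, Finset.univ_inter, Finset.sum_const, hD, smul_eq_mul,
        Nat.factorial_succ]

theorem spannedMod_normForm {a : σ → σ → K} (ha : ∀ j, Function.Injective fun i => a i j) :
    SpannedMod K (Ideal.span (Set.range (normForm a))) (Fintype.card σ).factorial := by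
  classical
  exact spannedMod_factorial ha _ Finset.univ Finset.univ 0 _ rfl rfl
    (fun i _ => Ideal.subset_span ⟨i, rfl⟩) (by simp) (by simp)

/-- If x j has a pole, then so does the j-th factor of every product, and each product must contain
a factor k i in the maximal ideal. Never k i = j, so k misses a value and two rows share the same k.
The difference of their entries then lies in the maximal ideal, although it is a unit. -/
theorem mem_valuationSubring_of_prod_mem {L : Type*} [Field L] (V : ValuationSubring L)
    {a : σ → σ → L} (x : σ → L) (haV : ∀ i j, a i j ∈ V)
    (hinv : ∀ i i' j, i ≠ i' → a i j ≠ a i' j ∧ (a i j - a i' j)⁻¹ ∈ V)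
    (hV : ∀ i, ∏ j, (x j - a i j) ∈ V) (j : σ) : x j ∈ V := by
  classical
  by_contra hj
  have h1 : ∀ i, ∃ k, V.valuation (x k - a i k) < 1 := by
    intro i
    by_contra! h
    have h2 : 1 < V.valuation (x j - a i j) := by
      by_contra! h3
      exact hj (by simpa using V.add_mem _ _ ((V.valuation_le_one_iff _).1 h3) (haV i j))
    have h3 := (V.valuation_le_one_iff _).2 (hV i)
    rw [map_prod, ← Finset.mul_prod_erase _ _ (Finset.mem_univ j)] at h3
    have h4 : 1 ≤ ∏ k ∈ Finset.univ.erase j, V.valuation (x k - a i k) :=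
      Finset.one_le_prod' fun k _ => h k
    exact absurd h3 (not_le.2 (lt_of_lt_of_le h2 (le_mul_of_one_le_right' h4)))
  choose k hk using h1
  have hks : ¬ Function.Surjective k := by
    intro hs
    obtain ⟨i, rfl⟩ := hs j
    exact hj (by simpa using V.add_mem _ _ ((V.valuation_le_one_iff _).1 (hk i).le) (haV i (k i)))
  rw [← Finite.injective_iff_surjective] at hks
  rw [Function.Injective] at hks
  push Not at hks
  obtain ⟨i, i', e, hne⟩ := hks
  have h1 : V.valuation (a i' (k i') - a i (k i')) < 1 := by
    have h2 := hk i
    rw [e] at h2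
    have h3 := V.valuation.map_sub_lt h2 (hk i')
    rwa [sub_sub_sub_cancel_left] at h3
  obtain ⟨h2, h3⟩ := hinv i' i (k i') hne.symm
  have h4 := (V.valuation_le_one_iff _).2 h3
  have h5 := mul_lt_one_of_lt_of_le h1 h4
  rw [← map_mul, mul_inv_cancel₀ (sub_ne_zero.2 h2), map_one] at h5
  exact lt_irrefl _ h5

end NormForms

end Furedi

namespace Furedi

open MvPolynomial

/-! ### Finiteness and generic degree of the map given by the norm forms. -/

section NormMap

variable {K σ : Type*} [Field K] [Fintype σ]

/-- The integral closure of a subring of a field is the intersection of the valuation rings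
containing it, so the valuation criterion applies in the fraction field. -/
theorem isIntegralElem_aeval_normForm {a : σ → σ → K}
    (ha : ∀ j, Function.Injective fun i => a i j) (j : σ) :
    (aeval (R := K) (normForm a)).toRingHom.IsIntegralElem (X j) := by
  classical
  set φ := (aeval (R := K) (normForm a)).toRingHom with hφ
  have hφC : ∀ c, φ (C c) = C c := fun c => by simp [hφ]
  have hφX : ∀ i, φ (X i) = normForm a i := fun i => by simp [hφ]
  let A := MvPolynomial σ K
  let L := FractionRing A
  let ι := algebraMap A L
  have hι : Function.Injective ι := IsFractionRing.injective A L
  let ψ : A →+* L := ι.comp φ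
  have hmem : ι (X j) ∈ (⨅ V : {V : ValuationSubring L // (ψ.range : Set L) ⊆ V.toSubring},
      V.1.toSubring) := by
    rw [Subring.mem_iInf]
    rintro ⟨V, hV⟩
    have hC : ∀ c : K, ι (C c) ∈ V := fun c => hV ⟨C c, congrArg ι (hφC c)⟩
    refine mem_valuationSubring_of_prod_mem V (a := fun i j => ι (C (a i j)))
      (fun j => ι (X j)) (fun i j => hC _) ?_ ?_ j
    · intro i i' k hne
      have h1 : a i k - a i' k ≠ 0 := sub_ne_zero.2 fun h => hne (ha k h)
      refine ⟨fun h => h1 (sub_eq_zero.2 (C_injective _ _ (hι h))), ?_⟩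
      have : (ι (C (a i k)) - ι (C (a i' k)))⁻¹ = ι (C (a i k - a i' k)⁻¹) := by
        rw [← map_sub, ← C_sub]
        refine inv_eq_of_mul_eq_one_right ?_
        rw [← map_mul, ← C_mul, mul_inv_cancel₀ h1, C_1, map_one]
      rw [this]
      exact hC _
    · intro i
      have : ∏ k, (ι (X k) - ι (C (a i k))) = ψ (X i) := by
        refine Eq.trans ?_ (congrArg ι (hφX i)).symm
        simp only [normForm, map_prod, map_sub]
      rw [this]
      exact hV ⟨_, rfl⟩
  rw [iInf_valuationSubring_superset] at hmem
  rw [Subring.closure_eq] at hmem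
  obtain ⟨p, hp, hp0⟩ := hmem
  have hs : Function.Surjective ψ.rangeRestrict := ψ.rangeRestrict_surjective
  obtain ⟨P, hP, -, hPm⟩ := Polynomial.lifts_and_degree_eq_and_monic
    ((Polynomial.mem_lifts _).2 (Polynomial.map_surjective _ hs p)) hp
  refine ⟨P, hPm, hι ?_⟩
  rw [map_zero, Polynomial.hom_eval₂, ← hp0, ← hP, Polynomial.eval₂_map]
  rfl

/-- The polynomial ring is integral over the algebra generated by these |σ| elements and has
transcendence degree |σ|, so they form a transcendence basis. -/
theorem algebraicIndependent_normForm {a : σ → σ → K}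
    (ha : ∀ j, Function.Injective fun i => a i j) :
    AlgebraicIndependent K (normForm a) := by
  have h : ∀ j, IsIntegral (Algebra.adjoin K (Set.range (normForm a))) (X j : MvPolynomial σ K) := by
    intro j
    obtain ⟨p, hp, hp0⟩ := isIntegralElem_aeval_normForm ha j
    have hm : ∀ x, aeval (R := K) (normForm a) x ∈ Algebra.adjoin K (Set.range (normForm a)) := by
      intro x
      rw [Algebra.adjoin_range_eq_range_aeval]
      exact ⟨x, rfl⟩
    let ρ := (aeval (R := K) (normForm a)).codRestrict _ hm
    refine ⟨p.map ρ.toRingHom, hp.map _, ?_⟩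
    rw [Polynomial.eval₂_map, ← hp0]
    rfl
  have : Algebra.IsIntegral (Algebra.adjoin K (Set.range (normForm a))) (MvPolynomial σ K) := by
    constructor
    intro f
    induction f using MvPolynomial.induction_on with
    | C c =>
      exact isIntegral_algebraMap (R := Algebra.adjoin K (Set.range (normForm a)))
        (x := algebraMap K _ c)
    | add p q hp hq => exact hp.add hq
    | mul_X p j hp => exact hp.mul (h j)
  exact (Algebra.IsAlgebraic.isTranscendenceBasis_of_lift_le_trdeg_of_finite K (normForm a)
    (by simp)).1

/-- The n + 1 elements r g^k have coordinate vectors of length at most n, hence are dependent. The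
relation is a nonzero polynomial of degree at most n killing g, and over an integrally closed domain
the minimal polynomial has least degree among these. -/
theorem exists_minpoly_natDegree_le {R A : Type*} [CommRing R] [IsDomain R] [IsIntegrallyClosed R]
    [CommRing A] [IsDomain A] [Algebra R A] [Module.IsTorsionFree R A] {n : ℕ} (s : Finset A)
    (hs : s.card ≤ n) {r : R} (hr : r ≠ 0)
    (h : ∀ x : A, r • x ∈ Submodule.span R (s : Set A)) (g : A) :
    (minpoly R g).natDegree ≤ n := by
  classical
  have h1 : ∀ k : Fin (n + 1), ∃ c : s → R, ∑ i, c i • (i : A) = r • g ^ (k : ℕ) := by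
    intro k
    have h2 := h (g ^ (k : ℕ))
    rw [← Subtype.range_coe (s := (s : Set A))] at h2
    exact (Submodule.mem_span_range_iff_exists_fun R).1 h2
  choose c hc using h1
  have hdep : ¬ LinearIndependent R c := by
    intro hli
    have := hli.fintype_card_le_finrank
    simp at this
    omega
  rw [Fintype.linearIndependent_iff] at hdep
  push Not at hdep
  obtain ⟨d, hd, k, hk⟩ := hdep
  have h0 : ∑ k, d k • (r • g ^ (k : ℕ)) = 0 := by
    simp_rw [← hc, Finset.smul_sum]
    rw [Finset.sum_comm]
    refine Finset.sum_eq_zero fun i _ => ?_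
    have := congrFun hd i
    simp only [Finset.sum_apply, Pi.smul_apply, smul_eq_mul, Pi.zero_apply] at this
    simp_rw [smul_smul, ← Finset.sum_smul]
    rw [this, zero_smul]
  let p : Polynomial R := ∑ k : Fin (n + 1), Polynomial.monomial (k : ℕ) (d k * r)
  have hp0 : p ≠ 0 := by
    intro hp
    have := congrArg (fun q => Polynomial.coeff q (k : ℕ)) hp
    simp only [p, Polynomial.finsetSum_coeff, Polynomial.coeff_monomial, Polynomial.coeff_zero,
      Fin.val_inj, Finset.sum_ite_eq', Finset.mem_univ, if_true] at this
    exact (mul_ne_zero hk hr) this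
  have hpg : Polynomial.aeval g p = 0 := by
    rw [← h0]
    simp only [p, map_sum, Polynomial.aeval_monomial, Algebra.smul_def, map_mul, mul_assoc]
  have hdeg : p.natDegree ≤ n := by
    refine Polynomial.natDegree_sum_le_of_forall_le _ _ fun k _ => ?_
    exact (Polynomial.natDegree_monomial_le _).trans (Nat.lt_succ_iff.1 k.2)
  exact (Polynomial.natDegree_le_natDegree
    (minpoly.IsIntegrallyClosed.degree_le_of_ne_zero hp0 hpg)).trans hdeg

end NormMap

end Furedi

namespace Furedi

open MvPolynomial

/-! ### Bounding every fibre by the generic degree. -/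

section NormMap

variable {K σ : Type*} [Field K] [Fintype σ]

/-- Over an infinite field some linear functional is nonzero on each of the finitely many
differences of points. -/
theorem exists_linear_injOn [Infinite K] (Z : Finset (σ → K)) :
    ∃ g : MvPolynomial σ K, Set.InjOn (fun p => eval p g) (Z : Set (σ → K)) := by
  classical
  let v : Z.offDiag → (σ → K) := fun x => x.1.1 - x.1.2
  obtain ⟨d, hd⟩ := Module.exists_dual_forall_apply_ne_zero (K := K) v fun x =>
    sub_ne_zero.2 (Finset.mem_offDiag.1 x.2).2.2
  refine ⟨∑ j, C (d (Pi.single j 1)) * X j, fun p hp p' hp' e => ?_⟩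
  by_contra hne
  refine hd ⟨(p, p'), Finset.mem_offDiag.2 ⟨hp, hp', hne⟩⟩ ?_
  have h : ∀ p : σ → K, eval p (∑ j, C (d (Pi.single j 1)) * X j) = d p := by
    intro p
    conv_rhs => rw [← Finset.univ_sum_single p]
    simp only [map_sum, map_mul, eval_C, eval_X]
    refine Finset.sum_congr rfl fun j _ => ?_
    rw [mul_comm, ← smul_eq_mul, ← map_smul, ← Pi.single_smul, smul_eq_mul, mul_one]
  simp only [h] at e
  rw [map_sub, e, sub_self]

theorem card_fiber_le_of_infinite [Infinite K] {a : σ → σ → K}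
    (ha : ∀ j, Function.Injective fun i => a i j) (b : σ → K) (Z : Finset (σ → K))
    (hZ : ∀ p ∈ Z, ∀ i, ∏ j, (p j - a i j) = b i) : Z.card ≤ (Fintype.card σ).factorial := by
  classical
  rcases Z.eq_empty_or_nonempty with rfl | ⟨p₀, hp₀⟩
  · simp
  let φ := aeval (R := K) (normForm a)
  let R := φ.range
  have hφ : Function.Injective φ := algebraicIndependent_normForm ha
  have : IsIntegrallyClosed R :=
    IsIntegrallyClosed.of_equiv (AlgEquiv.ofInjective φ hφ).toRingEquiv
  have hint : ∀ j, IsIntegral R (X j : MvPolynomial σ K) := by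
    intro j
    obtain ⟨p, hp, hp0⟩ := isIntegralElem_aeval_normForm ha j
    refine ⟨p.map φ.rangeRestrict.toRingHom, hp.map _, ?_⟩
    rw [Polynomial.eval₂_map, ← hp0]
    rfl
  have : Algebra.IsIntegral R (MvPolynomial σ K) := by
    constructor
    intro f
    induction f using MvPolynomial.induction_on with
    | C c => exact isIntegral_algebraMap (R := R) (x := algebraMap K _ c)
    | add p q hp hq => exact hp.add hq
    | mul_X p j hp => exact hp.mul (hint j)
  have : Algebra.FiniteType R (MvPolynomial σ K) :=
    Algebra.FiniteType.of_restrictScalars_finiteType K R _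
  have : Module.Finite R (MvPolynomial σ K) := Algebra.IsIntegral.finite
  obtain ⟨s, hs, hsp⟩ := spannedMod_normForm ha
  let F : σ → R := fun i => ⟨normForm a i, X i, by simp [φ]⟩
  let I : Ideal R := Ideal.span (Set.range F)
  -- The length bound for the fibre over 0 is the hypothesis of Nakayama's lemma for the ideal I of
  -- the origin.
  have hle : (⊤ : Submodule R (MvPolynomial σ K)) ≤
      Submodule.span R (s : Set (MvPolynomial σ K)) ⊔ I • ⊤ := by
    intro f _
    obtain ⟨g, hg, hfg⟩ := hsp f
    have h1 : f - g ∈ I • (⊤ : Submodule R (MvPolynomial σ K)) := by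
      obtain ⟨c, hc⟩ := (Ideal.mem_span_range_iff_exists_fun).1 hfg
      rw [← hc]
      refine Submodule.sum_mem _ fun i _ => ?_
      have : c i * normForm a i = F i • c i := mul_comm _ _
      rw [this]
      exact Submodule.smul_mem_smul (Ideal.subset_span ⟨i, rfl⟩) trivial
    have h2 : g ∈ Submodule.span R (s : Set (MvPolynomial σ K)) :=
      Submodule.span_le_restrictScalars K R _ hg
    simpa using Submodule.add_mem_sup h2 h1
  obtain ⟨r, hrI, hr⟩ := Submodule.exists_sub_one_mem_and_smul_le_of_fg_of_le_sup
    Module.Finite.fg_top le_top hle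
  -- Since r ≡ 1 mod I, it suffices that I is proper: all norm forms vanish at the diagonal point a
  -- j j.
  have hr0 : r ≠ 0 := by
    rintro rfl
    let p : σ → K := fun j => a j j
    have h1 : I ≤ RingHom.ker ((eval p).comp R.val.toRingHom) := by
      refine Ideal.span_le.2 ?_
      rintro _ ⟨i, rfl⟩
      change eval p (normForm a i) = 0
      simp only [normForm, map_prod, map_sub, eval_X, eval_C]
      exact Finset.prod_eq_zero (Finset.mem_univ i) (sub_self _)
    have h2 := h1 hrI
    rw [RingHom.mem_ker] at h2
    simp at h2
  have hspan : ∀ f : MvPolynomial σ K, r • f ∈ Submodule.span R (s : Set (MvPolynomial σ K)) :=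
    fun f => hr (Submodule.smul_mem_pointwise_smul f r ⊤ trivial)
  obtain ⟨g, hg⟩ := exists_linear_injOn Z
  have hdeg := exists_minpoly_natDegree_le s hs hr0 hspan g
  have hmonic := minpoly.monic (Algebra.IsIntegral.isIntegral (R := R) g)
  let ev : (σ → K) → R →+* K := fun p => (eval p).comp R.val.toRingHom
  -- R is generated by the norm forms, whose values on Z are prescribed. So all points of Z
  -- specialise the minimal polynomial of g to the same P.
  have hev : ∀ p ∈ Z, ev p = ev p₀ := by
    intro p hp
    ext ⟨_, y, rfl⟩
    have h1 : ∀ p ∈ Z, eval p (φ y) = eval b y := by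
      intro p hp
      have h2 : (eval p).comp φ.toRingHom = eval b := by
        refine MvPolynomial.ringHom_ext (fun c => by simp [φ]) fun i => ?_
        simp only [AlgHom.toRingHom_eq_coe, RingHom.comp_apply, RingHom.coe_coe, φ, aeval_X,
          normForm, map_prod, map_sub, eval_X, eval_C]
        exact hZ p hp i
      exact RingHom.congr_fun h2 y
    exact (h1 p hp).trans (h1 p₀ hp₀).symm
  let P := (minpoly R g).map (ev p₀)
  have hP0 : P ≠ 0 := (hmonic.map _).ne_zero
  have hroot : ∀ p ∈ Z, P.eval (eval p g) = 0 := by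
    intro p hp
    simp only [P]
    rw [← hev p hp, Polynomial.eval_map]
    have h1 := congrArg (eval p) (minpoly.aeval R g)
    rw [map_zero, Polynomial.aeval_def, Polynomial.hom_eval₂] at h1
    exact h1
  calc Z.card = (Z.image fun p => eval p g).card := (Finset.card_image_of_injOn hg).symm
    _ ≤ P.roots.toFinset.card := by
        refine Finset.card_le_card fun x hx => ?_
        obtain ⟨p, hp, rfl⟩ := Finset.mem_image.1 hx
        rw [Multiset.mem_toFinset, Polynomial.mem_roots hP0]
        exact hroot p hp
    _ ≤ P.natDegree := (Multiset.toFinset_card_le _).trans (Polynomial.card_roots' P)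
    _ ≤ _ := Polynomial.natDegree_map_le.trans hdeg

/-- A system `∏ j, (x j - a i j) = b i` of `m` equations in `m` unknowns, with `a i j ≠ a i' j`
for `i ≠ i'`, has at most `m!` solutions. -/
theorem card_fiber_le {a : σ → σ → K} (ha : ∀ j, Function.Injective fun i => a i j) (b : σ → K)
    (Z : Finset (σ → K)) (hZ : ∀ p ∈ Z, ∀ i, ∏ j, (p j - a i j) = b i) :
    Z.card ≤ (Fintype.card σ).factorial := by
  classical
  -- The separating linear form needs an infinite field; extending scalars loses no solutions.
  let ι := algebraMap K (AlgebraicClosure K)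
  have hι : Function.Injective ι := (algebraMap K (AlgebraicClosure K)).injective
  have h := card_fiber_le_of_infinite (a := fun i j => ι (a i j))
    (fun j i i' e => ha j (hι e)) (fun i => ι (b i)) (Z.image fun p j => ι (p j)) ?_
  · rwa [Finset.card_image_of_injective] at h
    exact fun p p' e => funext fun j => hι (congrFun e j)
  · intro p hp i
    obtain ⟨p, hp', rfl⟩ := Finset.mem_image.1 hp
    simp only [← map_sub, ← map_prod, hZ p hp' i]

end NormMap

end Furedi

namespace Furedi

/-! ### Norm equations in finite fields. -/

section Norm

variable {F : Type*} [Field F] [Finite F]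

theorem exists_prime_charP_of_card {q m : ℕ} (hq : IsPrimePow q)
    (hF : Nat.card F = q ^ m) : ∃ p k : ℕ, p.Prime ∧ CharP F p ∧ q = p ^ k := by
  have := Fintype.ofFinite F
  obtain ⟨p, k, hp, -, rfl⟩ := (isPrimePow_nat_iff q).1 hq
  refine ⟨p, k, hp, ?_, rfl⟩
  obtain ⟨p', hp', n, hp'p, hc⟩ : ∃ p', CharP F p' ∧ ∃ n : ℕ+, p'.Prime ∧
      Fintype.card F = p' ^ (n : ℕ) := by
    obtain ⟨p', h⟩ := CharP.exists F
    obtain ⟨n, h1, h2⟩ := FiniteField.card F p'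
    exact ⟨p', h, n, h1, h2⟩
  rw [Nat.card_eq_fintype_card, hc, ← pow_mul] at hF
  have h1 : p' ∣ p ^ (k * m) := hF ▸ dvd_pow_self p' n.ne_zero
  rwa [← (Nat.prime_dvd_prime_iff_eq hp'p hp).1 (hp'p.dvd_of_dvd_pow h1)]

theorem sub_pow_primePow {q m : ℕ} (hq : IsPrimePow q) (hF : Nat.card F = q ^ m)
    (x y : F) (j : ℕ) : (x - y) ^ q ^ j = x ^ q ^ j - y ^ q ^ j := by
  obtain ⟨p, k, hp, hc, rfl⟩ := exists_prime_charP_of_card hq hF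
  have := Fact.mk hp
  rw [← pow_mul]
  exact sub_pow_char_pow x y _

theorem pow_primePow_injective {q m : ℕ} (hq : IsPrimePow q)
    (hF : Nat.card F = q ^ m) (j : ℕ) : Function.Injective fun x : F => x ^ q ^ j := by
  intro x y h
  have h1 := sub_pow_primePow hq hF x y j
  rw [sub_eq_zero.2 h] at h1
  exact sub_eq_zero.1 (eq_zero_of_pow_eq_zero h1)

/-- Prescribing the norms of the differences from `m` distinct elements of `GF(q ^ m)` leaves at
most `m!` elements. -/
theorem card_le_factorial_of_norm_sub {q m : ℕ} (hq : IsPrimePow q) (hm : m ≠ 0)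
    (hF : Nat.card F = q ^ m) {d : Fin m → F} (hd : Function.Injective d) (c : Fin m → F)
    (Z : Finset F) (hZ : ∀ z ∈ Z, ∀ i, (z - d i) ^ ∑ j ∈ Finset.range m, q ^ j = c i) :
    Z.card ≤ m.factorial := by
  classical
  -- The conjugates of z serve as independent unknowns: since x ↦ x^(q^j) is additive, the norm of z
  -- - d i is ∏_j (z^(q^j) - (d i)^(q^j)).
  let e : F → Fin m → F := fun z j => z ^ q ^ (j : ℕ)
  have he : Function.Injective e := fun z z' h =>
    pow_primePow_injective hq hF 0 (congrFun h ⟨0, Nat.pos_of_ne_zero hm⟩)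
  have h := card_fiber_le (a := fun i j : Fin m => d i ^ q ^ (j : ℕ))
    (fun j i i' h => hd (pow_primePow_injective hq hF j h)) c (Z.image e) ?_
  · rwa [Finset.card_image_of_injective _ he, Fintype.card_fin] at h
  · intro p hp i
    obtain ⟨z, hz, rfl⟩ := Finset.mem_image.1 hp
    rw [← hZ z hz i, ← Finset.prod_pow_eq_pow_sum, ← Fin.prod_univ_eq_prod_range
      (fun j => (z - d i) ^ q ^ j)]
    exact Finset.prod_congr rfl fun j _ => (sub_pow_primePow hq hF _ _ _).symm

end Norm

/-! ### Common neighbours of r vertices. -/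

section Free

variable {F : Type*} [Field F] [Finite F] {H : Subgroup Fˣ}

/-- The class of S k is determined by z k, the ratio of the values of the forms P 1 and P 0 there.
The norms of the m + 1 ratios g are t-th roots of unity, which leaves t^(m+1) systems of norm
equations for z, each with at most (m+1)! solutions. -/
theorem card_le_of_pairRel {q m t : ℕ} (hq : IsPrimePow q) (ht : 0 < t)
    (hF : Nat.card F = q ^ (m + 1))
    (hH : Nat.card H = t * ∑ i ∈ Finset.range (m + 1), q ^ i)
    (P : Fin (m + 2) → {p : F × F // p ≠ 0}) (hP : ∀ i j, pairSetoid H (P i) (P j) → i = j)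
    {κ : Type*} [Fintype κ] (S : κ → {p : F × F // p ≠ 0})
    (hS : ∀ k l, pairSetoid H (S k) (S l) → k = l)
    (hPS : ∀ i k, PairRel H (P i) (S k)) :
    Fintype.card κ ≤ t ^ (m + 1) * (m + 1).factorial := by
  classical
  rcases isEmpty_or_nonempty κ with hκ | ⟨⟨k₀⟩⟩
  · simp
  choose h hhH hh using hPS
  let D : Fin (m + 2) → Fin (m + 2) → F := fun i j =>
    (P i).1.1 * (P j).1.2 - (P i).1.2 * (P j).1.1
  have hD : ∀ i j, i ≠ j → D i j ≠ 0 := by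
    intro i j hij h0
    -- A zero determinant makes P i and P j proportional. The factor is the ratio of their values at
    -- the common neighbour S k₀, so it lies in H.
    refine hij (hP i j ⟨h i k₀ * (h j k₀)⁻¹, H.mul_mem (hhH _ _) (H.inv_mem (hhH _ _)), ?_, ?_⟩)
    · rw [Units.val_mul, mul_right_comm, Units.eq_mul_inv_iff_mul_eq, ← hh, ← hh]
      linear_combination (S k₀).1.2 * h0
    · rw [Units.val_mul, mul_right_comm, Units.eq_mul_inv_iff_mul_eq, ← hh, ← hh]
      linear_combination (-(S k₀).1.1) * h0
  let g : Fin (m + 2) → κ → Fˣ := fun i k => h i k * (h 0 k)⁻¹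
  let e := ∑ i ∈ Finset.range (m + 1), q ^ i
  have hg : ∀ i k, ((g i k : F) ^ e) ^ t = 1 := by
    intro i k
    have h1 : g i k ∈ H := H.mul_mem (hhH _ _) (H.inv_mem (hhH _ _))
    have h2 := pow_card_eq_one' (G := H) (x := ⟨g i k, h1⟩)
    rw [hH, mul_comm, pow_mul] at h2
    have h3 := congrArg (fun x : H => ((x : Fˣ) : F)) h2
    simpa using h3
  let z : κ → F := fun k => g 1 k
  -- This is the plane relation D₀₁ P_i = D_i₁ P₀ + D₀ᵢ P₁, paired with S k and divided by h 0 k.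
  have hz : ∀ i k, D 0 1 * g i k = D i 1 + D 0 i * z k := by
    intro i k
    have h0 : (h 0 k : F) ≠ 0 := (h 0 k).ne_zero
    simp only [z, g, D, Units.val_mul, Units.val_inv_eq_inv_val]
    field_simp
    rw [← hh, ← hh, ← hh]
    ring
  have hzinj : Function.Injective z := by
    intro k l hkl
    refine hS k l ⟨h 0 k * (h 0 l)⁻¹, H.mul_mem (hhH _ _) (H.inv_mem (hhH _ _)), ?_⟩
    have h01 : D 0 1 ≠ 0 := hD 0 1 (by simp)
    have hk0 : (h 0 k : F) ≠ 0 := (h 0 k).ne_zero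
    have hl0 : (h 0 l : F) ≠ 0 := (h 0 l).ne_zero
    simp only [z, g, Units.val_mul, Units.val_inv_eq_inv_val] at hkl ⊢
    rw [← div_eq_mul_inv, ← div_eq_mul_inv, div_eq_div_iff hk0 hl0] at hkl
    have e1 := hh 0 k
    have e2 := hh 0 l
    have e3 := hh 1 k
    have e4 := hh 1 l
    constructor
    · field_simp
      refine mul_left_cancel₀ h01 ?_
      simp only [D]
      rw [← e1, ← e2, ← e3, ← e4] at hkl
      rw [← e1, ← e2]
      linear_combination (-(P 0).1.2) * hkl
    · field_simp
      refine mul_left_cancel₀ h01 ?_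
      simp only [D]
      rw [← e1, ← e2, ← e3, ← e4] at hkl
      rw [← e1, ← e2]
      linear_combination ((P 0).1.1) * hkl
  -- The root of the affine function of z that gives g at i + 1. Index 0 is spent on normalisation,
  -- so m + 1 equations remain, as many as the degree of F over GF(q).
  let d : Fin (m + 1) → F := fun i => -(D i.succ 1 / D 0 i.succ)
  have hd : Function.Injective d := by
    intro i j hij
    by_contra hne
    have hi := hD 0 i.succ (Fin.succ_ne_zero i).symm
    have hj := hD 0 j.succ (Fin.succ_ne_zero j).symm
    have h1 := neg_injective hij
    rw [div_eq_div_iff hi hj] at h1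
    -- By the Plücker relation, equal roots would force D₀₁ D_ij = 0.
    refine mul_ne_zero (hD 0 1 (by simp)) (hD i.succ j.succ fun h => hne (Fin.succ_injective _ h)) ?_
    simp only [D] at h1 ⊢
    linear_combination h1
  let T : Finset F := (Polynomial.nthRoots t (1 : F)).toFinset
  have hT : T.card ≤ t := (Multiset.toFinset_card_le _).trans (Polynomial.card_nthRoots t 1)
  have hmaps : ∀ k ∈ (Finset.univ : Finset κ),
      (fun i : Fin (m + 1) => (g i.succ k : F) ^ e) ∈ Fintype.piFinset fun _ => T := by
    intro k _
    rw [Fintype.mem_piFinset]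
    intro i
    rw [Multiset.mem_toFinset, Polynomial.mem_nthRoots ht]
    exact hg _ _
  have hcard := Finset.card_le_mul_card_image_of_maps_to hmaps (m + 1).factorial ?_
  · rw [Finset.card_univ, Fintype.card_piFinset_const, mul_comm] at hcard
    exact hcard.trans (Nat.mul_le_mul_right _ (Nat.pow_le_pow_left hT _))
  · intro c _
    rw [← Finset.card_image_of_injective _ hzinj]
    refine card_le_factorial_of_norm_sub hq (Nat.succ_ne_zero m) hF hd
      (fun i => (D 0 1 / D 0 i.succ) ^ e * c i) _ fun x hx i => ?_
    obtain ⟨k, hk, rfl⟩ := Finset.mem_image.1 hx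
    rw [← congrFun (Finset.mem_filter.1 hk).2 i, ← mul_pow]
    congr 1
    have hi := hD 0 i.succ (Fin.succ_ne_zero i).symm
    have := hz i.succ k
    simp only [d]
    field_simp
    linear_combination -this

theorem graph_free {q m t : ℕ} (hq : IsPrimePow q) (ht : 0 < t)
    (hF : Nat.card F = q ^ (m + 1))
    (hH : Nat.card H = t * ∑ i ∈ Finset.range (m + 1), q ^ i) :
    (completeBipartiteGraph (Fin (m + 2)) (Fin (t ^ (m + 1) * (m + 1).factorial + 1))).Free
      (graph H) := by
  rintro ⟨f⟩
  have hf : Function.Injective f := f.injective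
  have h := card_le_of_pairRel hq ht hF hH (fun i => (f (Sum.inl i)).out)
    (fun i j hij => by
      have h1 := Quotient.out_equiv_out.1 hij
      exact Sum.inl_injective (hf h1))
    (κ := Fin (t ^ (m + 1) * (m + 1).factorial + 1)) (fun k => (f (Sum.inr k)).out)
    (fun i j hij => by
      have h1 := Quotient.out_equiv_out.1 hij
      exact Sum.inr_injective (hf h1))
    (fun i k => by
      have h1 : (graph H).Adj (f (Sum.inl i)) (f (Sum.inr k)) := f.toHom.map_adj (by simp)
      have h2 := h1.2
      rw [← Quotient.out_eq (f (Sum.inl i)), ← Quotient.out_eq (f (Sum.inr k))] at h2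
      exact h2)
  rw [Fintype.card_fin] at h
  omega

end Free

end Furedi

namespace Furedi

/-! ### The Fejér kernel. -/

open MeasureTheory Set

/-- The Fejér kernel of bandwidth `l`. -/
noncomputable def fejer (l u : ℝ) : ℝ := l * Real.sinc (l * u / 2) ^ 2

/-- The triangular weight on `[-l, l]`, whose Fourier transform is the Fejér kernel. -/
noncomputable def triangle (l τ : ℝ) : ℝ := 1 - |τ| / l

theorem continuous_fejer (l : ℝ) : Continuous (fejer l) := by
  have := Real.continuous_sinc
  unfold fejer
  fun_prop

theorem continuous_triangle (l : ℝ) : Continuous (triangle l) := by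
  unfold triangle
  fun_prop

theorem fejer_nonneg {l : ℝ} (hl : 0 < l) (u : ℝ) : 0 ≤ fejer l u := by
  unfold fejer
  positivity

theorem sinc_sq_le_one (x : ℝ) : Real.sinc x ^ 2 ≤ 1 := by
  rw [← sq_abs]
  exact pow_le_one₀ (abs_nonneg _) (Real.abs_sinc_le_one x)

theorem fejer_le {l : ℝ} (hl : 0 < l) (u : ℝ) : fejer l u ≤ l :=
  mul_le_of_le_one_right hl.le (sinc_sq_le_one _)

theorem fejer_eq {l u : ℝ} (hl : 0 < l) (hu : u ≠ 0) :
    fejer l u = 4 * Real.sin (l * u / 2) ^ 2 / (l * u ^ 2) := by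
  rw [fejer, Real.sinc_of_ne_zero (by positivity)]
  field_simp
  ring

theorem fejer_le_div {l u : ℝ} (hl : 0 < l) (hu : u ≠ 0) : fejer l u ≤ 4 / (l * u ^ 2) := by
  rw [fejer_eq hl hu]
  gcongr
  nlinarith [Real.sin_sq_le_one (l * u / 2)]

theorem integrable_fejer {l : ℝ} (hl : 0 < l) : Integrable (fejer l) := by
  have h1 : Integrable fun x : ℝ => Real.sinc x ^ 2 := by
    refine (integrable_inv_one_add_sq.const_mul 2).mono'
      (Real.continuous_sinc.pow 2).aestronglyMeasurable (ae_of_all _ fun x => ?_)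
    rw [Real.norm_of_nonneg (sq_nonneg _), ← div_eq_mul_inv, le_div_iff₀ (by positivity)]
    have h2 : (x * Real.sinc x) ^ 2 ≤ 1 := by
      rcases eq_or_ne x 0 with rfl | hx
      · simp
      · rw [Real.sinc_of_ne_zero hx, mul_div_cancel₀ _ hx]
        exact Real.sin_sq_le_one x
    nlinarith [sinc_sq_le_one x]
  have h2 := (h1.comp_mul_left' (R := l / 2) (by positivity)).const_mul l
  refine h2.congr (ae_of_all _ fun u => ?_)
  simp only [fejer]
  congr 3
  ring

theorem half_le_sinc {x : ℝ} (hx : |x| ≤ 1 / 2) : 1 / 2 ≤ Real.sinc x := by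
  rcases eq_or_ne x 0 with rfl | h0
  · norm_num
  wlog hpos : 0 < x generalizing x
  · rw [← Real.sinc_neg]
    exact this (by rwa [abs_neg]) (neg_ne_zero.2 h0)
      (neg_pos.2 (lt_of_le_of_ne (not_lt.1 hpos) h0))
  rw [abs_of_pos hpos] at hx
  rw [Real.sinc_of_ne_zero h0, le_div_iff₀ hpos]
  have := Real.sin_gt_sub_cube hpos
  nlinarith [mul_pos hpos hpos, mul_pos (mul_pos hpos hpos) hpos]

theorem quarter_le_fejer {l u : ℝ} (hl : 0 < l) (hu : |u| ≤ 1 / l) : l / 4 ≤ fejer l u := by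
  have h1 : |l * u / 2| ≤ 1 / 2 := by
    rw [abs_div, abs_mul, abs_of_pos hl, abs_two]
    have := mul_le_mul_of_nonneg_left hu hl.le
    rw [mul_one_div_cancel hl.ne'] at this
    linarith
  have h2 := half_le_sinc h1
  rw [fejer]
  nlinarith [mul_le_mul h2 h2 (by norm_num) (by linarith)]

/-- Away from the origin, a narrow Fejér kernel is dominated by two translates of a wide one. -/
theorem fejer_le_translates {l η u : ℝ} (hl : 0 < l) (hη : 0 < η) (hu : η ≤ |u|) :
    fejer l u ≤ (1 + Real.pi / η) ^ 2 / l * (fejer 1 u + fejer 1 (u + Real.pi)) := by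
  have hu0 : u ≠ 0 := abs_pos.1 (hη.trans_le hu)
  have hpi := Real.pi_pos
  -- Split 4/u² by sin² + cos² = 1 at u/2. Translation by π turns the sine into the cosine, and (1 +
  -- π/η)² pays for replacing u² by (u + π)².
  have key : 4 / u ^ 2 ≤ (1 + Real.pi / η) ^ 2 * (fejer 1 u + fejer 1 (u + Real.pi)) := by
    have h1 : 1 ≤ (1 + Real.pi / η) ^ 2 := by
      have : 0 < Real.pi / η := by positivity
      nlinarith
    rw [fejer_eq one_pos hu0]
    -- At u = -π the quotient formula for the translate fails, but there the sine term alone is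
    -- enough.
    rcases eq_or_ne (u + Real.pi) 0 with h0 | h0
    · have h2 : u = -Real.pi := by linarith
      have h3 : Real.sin (1 * u / 2) ^ 2 = 1 := by
        rw [h2, show 1 * -Real.pi / 2 = -(Real.pi / 2) by ring, Real.sin_neg, Real.sin_pi_div_two]
        norm_num
      rw [h3, mul_one, one_mul]
      have h4 := fejer_nonneg one_pos (u + Real.pi)
      have h5 : 0 ≤ 4 / u ^ 2 := by positivity
      nlinarith [mul_nonneg (sub_nonneg.2 h1) h5, mul_nonneg (zero_le_one.trans h1) h4]
    · rw [fejer_eq one_pos h0,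
        show 1 * (u + Real.pi) / 2 = 1 * u / 2 + Real.pi / 2 by ring, Real.sin_add_pi_div_two,
        one_mul, one_mul, one_mul]
      have h2 : (u + Real.pi) ^ 2 ≤ (1 + Real.pi / η) ^ 2 * u ^ 2 := by
        rw [← mul_pow, ← sq_abs, ← sq_abs ((1 + Real.pi / η) * u), abs_mul,
          abs_of_pos (a := 1 + Real.pi / η) (by positivity)]
        have h3 : Real.pi ≤ Real.pi / η * |u| := by
          rw [div_mul_eq_mul_div, le_div_iff₀ hη]
          exact mul_le_mul_of_nonneg_left hu hpi.le
        have h4 : |u + Real.pi| ≤ |u| + Real.pi := by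
          simpa [abs_of_pos hpi] using abs_add_le u Real.pi
        gcongr
        linarith
      have h3 : 4 * Real.cos (u / 2) ^ 2 / u ^ 2 ≤
          (1 + Real.pi / η) ^ 2 * (4 * Real.cos (u / 2) ^ 2 / (u + Real.pi) ^ 2) := by
        rw [← mul_div_assoc, div_le_div_iff₀ (by positivity) (by positivity)]
        nlinarith [mul_le_mul_of_nonneg_left h2 (sq_nonneg (Real.cos (u / 2)))]
      have h4 : 4 * Real.sin (u / 2) ^ 2 / u ^ 2 ≤
          (1 + Real.pi / η) ^ 2 * (4 * Real.sin (u / 2) ^ 2 / u ^ 2) :=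
        le_mul_of_one_le_left (by positivity) h1
      calc 4 / u ^ 2 = 4 * Real.sin (u / 2) ^ 2 / u ^ 2 + 4 * Real.cos (u / 2) ^ 2 / u ^ 2 := by
            rw [← add_div, ← mul_add, Real.sin_sq_add_cos_sq, mul_one]
        _ ≤ _ := by rw [mul_add]; exact add_le_add h4 h3
  calc fejer l u ≤ 4 / (l * u ^ 2) := fejer_le_div hl hu0
    _ = 4 / u ^ 2 / l := by field_simp
    _ ≤ _ := by rw [div_mul_eq_mul_div]; gcongr

theorem integral_triangle_mul_cos {l : ℝ} (hl : 0 < l) (u : ℝ) :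
    ∫ τ in (0 : ℝ)..l, 2 * (triangle l τ * Real.cos (τ * u)) = fejer l u := by
  have h0 : ∫ τ in (0 : ℝ)..l, 2 * (triangle l τ * Real.cos (τ * u)) =
      ∫ τ in (0 : ℝ)..l, 2 * ((1 - τ / l) * Real.cos (τ * u)) := by
    refine intervalIntegral.integral_congr fun τ hτ => ?_
    rw [uIcc_of_le hl.le] at hτ
    simp only [triangle, abs_of_nonneg hτ.1]
  rw [h0]
  rcases eq_or_ne u 0 with rfl | hu
  · have : ∀ τ ∈ uIcc 0 l, HasDerivAt (fun τ => 2 * τ - τ ^ 2 / l)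
        (2 * ((1 - τ / l) * Real.cos (τ * 0))) τ := by
      intro τ _
      have h1 := ((hasDerivAt_id τ).const_mul 2).sub (((hasDerivAt_id τ).pow 2).div_const l)
      convert! h1 using 1
      simp
      ring
    rw [intervalIntegral.integral_eq_sub_of_hasDerivAt this
      (Continuous.intervalIntegrable (by fun_prop) _ _)]
    simp only [fejer, mul_zero, zero_div, Real.sinc_zero]
    field_simp
    ring
  · have : ∀ τ ∈ uIcc 0 l, HasDerivAt (fun τ => 2 * ((1 - τ / l) * (Real.sin (τ * u) / u)) -
        2 * (Real.cos (τ * u) / (l * u ^ 2))) (2 * ((1 - τ / l) * Real.cos (τ * u))) τ := by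
      intro τ _
      have h2 : HasDerivAt (fun τ : ℝ => τ * u) u τ := by
        simpa using (hasDerivAt_id τ).mul_const u
      have h1 : HasDerivAt (fun τ : ℝ => 1 - τ / l) (-(1 / l)) τ := by
        simpa using ((hasDerivAt_id τ).div_const l).const_sub 1
      have h3 := ((h1.mul (h2.sin.div_const u)).const_mul 2).sub
        ((h2.cos.div_const (l * u ^ 2)).const_mul 2)
      convert! h3 using 1
      field_simp
      ring
    rw [intervalIntegral.integral_eq_sub_of_hasDerivAt this
      (Continuous.intervalIntegrable (by fun_prop) _ _), fejer_eq hl hu, Real.sin_sq_eq_half_sub,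
      show 2 * (l * u / 2) = l * u by ring]
    simp only [zero_div, zero_mul, Real.sin_zero, Real.cos_zero, div_self hl.ne']
    field_simp
    ring

theorem integral_triangle_mul_exp {l : ℝ} (hl : 0 < l) (u : ℝ) :
    ∫ τ in (-l)..l, (triangle l τ : ℂ) * Complex.exp (τ * u * Complex.I) = fejer l u := by
  have hc := continuous_triangle l
  have hcont : Continuous fun τ : ℝ =>
      (triangle l τ : ℂ) * Complex.exp (τ * u * Complex.I) := by fun_prop
  rw [← intervalIntegral.integral_add_adjacent_intervals (b := 0)
    (hcont.intervalIntegrable _ _) (hcont.intervalIntegrable _ _)]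
  have h1 := intervalIntegral.integral_comp_neg (a := 0) (b := l)
    fun τ : ℝ => (triangle l τ : ℂ) * Complex.exp (τ * u * Complex.I)
  rw [neg_zero] at h1
  have hneg : IntervalIntegrable (fun τ : ℝ =>
      (triangle l (-τ) : ℂ) * Complex.exp ((-τ : ℝ) * u * Complex.I)) volume 0 l :=
    (hcont.comp continuous_neg).intervalIntegrable _ _
  rw [← h1, ← intervalIntegral.integral_add hneg (hcont.intervalIntegrable _ _),
    ← integral_triangle_mul_cos hl u, ← intervalIntegral.integral_ofReal]
  refine intervalIntegral.integral_congr fun τ _ => ?_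
  have h2 : triangle l (-τ) = triangle l τ := by simp [triangle]
  simp only [h2]
  push_cast
  rw [mul_left_comm, Complex.two_cos, ← mul_add, add_comm]
  congr 3
  ring_nf

end Furedi

namespace Furedi

/-! ### Fejér averages of Dirichlet series. -/

open MeasureTheory Set Complex

theorem abs_triangle_le_one {l τ : ℝ} (hl : 0 < l) (hτ : |τ| ≤ l) : |triangle l τ| ≤ 1 := by
  have h1 : |τ| / l ≤ 1 := (div_le_one hl).2 hτ
  have h2 : 0 ≤ |τ| / l := by positivity
  rw [triangle, abs_le]
  constructor <;> linarith

theorem abs_le_of_mem_uIoc {l τ : ℝ} (hl : 0 < l) (hτ : τ ∈ uIoc (-l) l) : |τ| ≤ l := by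
  rw [uIoc_of_le (by linarith)] at hτ
  exact abs_le.2 ⟨hτ.1.le, hτ.2⟩

theorem norm_exp_mul_mul_I (x y : ℝ) : ‖cexp (x * y * I)‖ = 1 := by
  rw [← ofReal_mul, norm_exp_ofReal_mul_I]

theorem LSeries_term_add_mul_I {a : ℕ → ℝ} (h0 : a 0 = 0) (σ τ : ℝ) (n : ℕ) :
    LSeries.term (fun n => (a n : ℂ)) (σ + τ * I) n =
      ((a n / (n : ℝ) ^ σ : ℝ) : ℂ) * cexp (-(τ * Real.log n * I)) := by
  rcases eq_or_ne n 0 with rfl | hn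
  · simp [h0]
  · have hn' : (n : ℂ) ≠ 0 := Nat.cast_ne_zero.2 hn
    rw [LSeries.term_of_ne_zero hn, cpow_add _ _ hn', ofReal_div, ofReal_cpow n.cast_nonneg,
      ofReal_natCast, div_mul_eq_div_div, div_eq_mul_inv (_ / _), cpow_def_of_ne_zero hn',
      cpow_def_of_ne_zero hn', ← exp_neg, ← natCast_log]
    congr 2
    ring

theorem summable_div_rpow {a : ℕ → ℝ} (h0 : a 0 = 0) (hpos : ∀ n, 0 ≤ a n) {σ : ℝ}
    (h : LSeriesSummable (fun n => (a n : ℂ)) σ) : Summable fun n : ℕ => a n / (n : ℝ) ^ σ := by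
  refine (summable_norm_iff.2 h).congr fun n => ?_
  have := LSeries_term_add_mul_I h0 σ 0 n
  simp only [ofReal_zero, zero_mul, add_zero, neg_zero, Complex.exp_zero, mul_one] at this
  rw [this, norm_real, Real.norm_of_nonneg (div_nonneg (hpos n) (by positivity))]

/-- On the line re s = σ the series converges absolutely, so it may be integrated termwise against
the triangle; the term n^(-iτ) contributes the kernel centred at log n. -/
theorem hasSum_fejer {a : ℕ → ℝ} (h0 : a 0 = 0) (hpos : ∀ n, 0 ≤ a n) {l σ : ℝ} (hl : 0 < l)
    (y : ℝ) (h : LSeriesSummable (fun n => (a n : ℂ)) σ) :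
    HasSum (fun n : ℕ => ((a n / (n : ℝ) ^ σ * fejer l (y - Real.log n) : ℝ) : ℂ))
      (∫ τ in (-l)..l, (triangle l τ : ℂ) * cexp (τ * y * I) *
        LSeries (fun n => (a n : ℂ)) (σ + τ * I)) := by
  have hc := continuous_triangle l
  have hs := summable_div_rpow h0 hpos h
  have hnn : ∀ n : ℕ, 0 ≤ a n / (n : ℝ) ^ σ := fun n => div_nonneg (hpos n) (by positivity)
  have hterm : ∀ n (τ : ℝ), (triangle l τ : ℂ) * cexp (τ * y * I) *
      LSeries.term (fun n => (a n : ℂ)) (σ + τ * I) n =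
      ((a n / (n : ℝ) ^ σ : ℝ) : ℂ) *
        ((triangle l τ : ℂ) * cexp (τ * (y - Real.log n : ℝ) * I)) := by
    intro n τ
    rw [LSeries_term_add_mul_I h0, ofReal_sub, mul_sub, sub_mul, sub_eq_add_neg, Complex.exp_add]
    ring
  have key := intervalIntegral.hasSum_integral_of_dominated_convergence (μ := volume)
    (a := -l) (b := l) (fun n _ => a n / (n : ℝ) ^ σ)
    (F := fun n τ => (triangle l τ : ℂ) * cexp (τ * y * I) *
      LSeries.term (fun n => (a n : ℂ)) (σ + τ * I) n)
    (f := fun τ => (triangle l τ : ℂ) * cexp (τ * y * I) *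
        LSeries (fun n => (a n : ℂ)) (σ + τ * I)) ?_ ?_ ?_ ?_ ?_
  · convert! key using 2 with n
    simp_rw [hterm]
    rw [intervalIntegral.integral_const_mul, integral_triangle_mul_exp hl, ofReal_mul]
  · intro n
    simp_rw [hterm]
    exact Continuous.aestronglyMeasurable (by fun_prop)
  · intro n
    refine ae_of_all _ fun τ hτ => ?_
    rw [hterm, norm_mul, norm_mul, norm_exp_mul_mul_I, norm_real, norm_real, mul_one,
      Real.norm_of_nonneg (hnn n)]
    exact mul_le_of_le_one_right (hnn n) (abs_triangle_le_one hl (abs_le_of_mem_uIoc hl hτ))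
  · exact ae_of_all _ fun _ _ => hs
  · exact intervalIntegrable_const
  · refine ae_of_all _ fun τ _ => HasSum.mul_left _ ?_
    refine Summable.hasSum (f := LSeries.term (fun n => (a n : ℂ)) (σ + τ * I)) ?_
    exact LSeriesSummable.of_re_le_re (by simp) h

/-- Write 1/(δ + iτ) as the Laplace integral of exp(-(δ + iτ)v) and exchange integrals: the pole
acts like a continuous mass of density exp(-δv). -/
theorem integral_triangle_div {l δ : ℝ} (hl : 0 < l) (hδ : 0 < δ) (y : ℝ) :
    ∫ τ in (-l)..l, (triangle l τ : ℂ) * cexp (τ * y * I) * (1 / (δ + τ * I)) =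
      ((∫ v in Ioi (0 : ℝ), Real.exp (-δ * v) * fejer l (y - v) : ℝ) : ℂ) := by
  have hc := continuous_triangle l
  have h1 : ∀ τ : ℝ, (triangle l τ : ℂ) * cexp (τ * y * I) * (1 / (δ + τ * I)) =
      ∫ v in Ioi (0 : ℝ), (Real.exp (-δ * v) : ℂ) *
        ((triangle l τ : ℂ) * cexp (τ * (y - v : ℝ) * I)) := by
    intro τ
    have h2 := integral_exp_mul_complex_Ioi (a := -(δ + τ * I)) (by simpa using hδ) 0
    rw [ofReal_zero, mul_zero, Complex.exp_zero, neg_div_neg_eq] at h2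
    rw [← h2, ← integral_const_mul]
    refine integral_congr_ae (ae_of_all _ fun v => ?_)
    simp only
    rw [mul_assoc, ← Complex.exp_add, mul_left_comm, ofReal_exp, ← Complex.exp_add]
    congr 2
    push_cast
    ring
  simp_rw [h1]
  rw [intervalIntegral_integral_swap, ← integral_complex_ofReal]
  · refine integral_congr_ae (ae_of_all _ fun v => ?_)
    simp only
    rw [intervalIntegral.integral_const_mul, integral_triangle_mul_exp hl, ofReal_mul]
  · have hb : Integrable (fun p : ℝ × ℝ => (1 : ℝ) * Real.exp (-δ * p.2))
        ((volume.restrict (uIoc (-l) l)).prod (volume.restrict (Ioi 0))) := by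
      refine Integrable.mul_prod (f := fun _ : ℝ => (1 : ℝ))
        (g := fun v : ℝ => Real.exp (-δ * v)) ?_ ?_
      · have : IsFiniteMeasure (volume.restrict (uIoc (-l) l)) :=
          ⟨by simp [uIoc]⟩
        exact integrable_const _
      · exact integrableOn_exp_mul_Ioi (by linarith) 0
    refine hb.mono' (Continuous.aestronglyMeasurable (by unfold Function.uncurry; fun_prop)) ?_
    have hmem : ∀ᵐ p : ℝ × ℝ ∂((volume.restrict (uIoc (-l) l)).prod (volume.restrict (Ioi 0))),
        p.1 ∈ uIoc (-l) l := by
      have := ae_restrict_mem (μ := (volume : Measure ℝ)) (measurableSet_uIoc (a := -l) (b := l))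
      exact Measure.quasiMeasurePreserving_fst.ae this
    filter_upwards [hmem] with p hp
    simp only [Function.uncurry]
    rw [norm_mul, norm_mul, norm_exp_mul_mul_I, norm_real, norm_real, mul_one, one_mul,
      Real.norm_of_nonneg (Real.exp_pos _).le]
    exact mul_le_of_le_one_right (Real.exp_pos _).le
      (abs_triangle_le_one hl (abs_le_of_mem_uIoc hl hp))

end Furedi

namespace Furedi

/-! ### Passage to the boundary line re s = 1. -/

open MeasureTheory Set Complex

theorem continuous_comp_line {G : ℂ → ℂ} (hG : ContinuousOn G {s | 1 ≤ s.re}) {σ : ℝ}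
    (hσ : 1 ≤ σ) : Continuous fun τ : ℝ => G (σ + τ * I) :=
  hG.comp_continuous (by fun_prop) fun τ => by simpa using hσ

/-- The Riemann–Lebesgue lemma at frequency -y/(2π). -/
theorem tendsto_integral_triangle_zero (G : ℂ → ℂ) {l : ℝ} (hl : 0 < l) :
    Tendsto (fun y : ℝ => ∫ τ in (-l)..l, (triangle l τ : ℂ) * cexp (τ * y * I) * G (1 + τ * I))
      atTop (𝓝 0) := by
  have h1 := Real.tendsto_integral_exp_smul_cocompact
    ((Ioc (-l) l).indicator fun τ : ℝ => (triangle l τ : ℂ) * G (1 + τ * I))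
  have h2 : Tendsto (fun y : ℝ => -(y / (2 * Real.pi))) atTop (cocompact ℝ) := by
    have h3 : Tendsto (fun y : ℝ => y / (2 * Real.pi)) atTop atTop :=
      tendsto_id.atTop_div_const (by positivity)
    exact (tendsto_neg_atTop_atBot.comp h3).mono_right atBot_le_cocompact
  refine (h1.comp h2).congr fun y => ?_
  rw [intervalIntegral.integral_of_le (by linarith), ← integral_indicator measurableSet_Ioc]
  refine integral_congr_ae (ae_of_all _ fun τ => ?_)
  simp only [Circle.smul_def, Real.fourierChar_apply, smul_eq_mul]
  by_cases hτ : τ ∈ Ioc (-l) l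
  · rw [indicator_of_mem hτ, indicator_of_mem hτ]
    have : 2 * Real.pi * -(τ * -(y / (2 * Real.pi))) = τ * y := by field_simp
    rw [this, ofReal_mul]
    ring
  · rw [indicator_of_notMem hτ, indicator_of_notMem hτ, mul_zero]

theorem tendsto_integral_triangle_boundary {G : ℂ → ℂ} (hG : ContinuousOn G {s | 1 ≤ s.re})
    {l : ℝ} (hl : 0 < l) (y : ℝ) :
    Tendsto (fun δ : ℝ => ∫ τ in (-l)..l, (triangle l τ : ℂ) * cexp (τ * y * I) *
        G ((1 + δ : ℝ) + τ * I)) (𝓝[>] 0)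
      (𝓝 (∫ τ in (-l)..l, (triangle l τ : ℂ) * cexp (τ * y * I) * G (1 + τ * I))) := by
  have hc := continuous_triangle l
  have hcont : ContinuousOn (fun p : ℝ × ℝ => G ((1 + p.1 : ℝ) + p.2 * I)) (Ici 0 ×ˢ univ) :=
    hG.comp (Continuous.continuousOn (by fun_prop)) fun p hp => by
      simpa using hp.1
  obtain ⟨C, hC⟩ := ((isCompact_Icc (a := (0 : ℝ)) (b := 1)).prod
    (isCompact_Icc (a := -l) (b := l))).exists_bound_of_continuousOn
      (hcont.mono (prod_mono Icc_subset_Ici_self (subset_univ _)))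
  refine intervalIntegral.tendsto_integral_filter_of_dominated_convergence (fun _ => C) ?_ ?_ ?_ ?_
  · filter_upwards [self_mem_nhdsWithin] with δ hδ
    have := continuous_comp_line hG (σ := 1 + δ) (by linarith [mem_Ioi.1 hδ])
    exact Continuous.aestronglyMeasurable (Continuous.mul (by fun_prop) this)
  · filter_upwards [Ioc_mem_nhdsGT one_pos] with δ hδ
    refine ae_of_all _ fun τ hτ => ?_
    have hτ' := abs_le_of_mem_uIoc hl hτ
    rw [norm_mul, norm_mul, norm_exp_mul_mul_I, norm_real, mul_one]
    refine (mul_le_of_le_one_left (norm_nonneg _) (abs_triangle_le_one hl hτ')).trans ?_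
    exact hC (δ, τ) ⟨⟨hδ.1.le, hδ.2⟩, abs_le.1 hτ'⟩
  · exact intervalIntegrable_const
  · refine ae_of_all _ fun τ _ => Tendsto.const_mul _ ?_
    have h1 := (hcont (0, τ) ⟨self_mem_Ici, trivial⟩).tendsto
    have h2 : Tendsto (fun δ : ℝ => (δ, τ)) (𝓝[>] 0) (𝓝[Ici 0 ×ˢ univ] (0, τ)) := by
      rw [nhdsWithin_prod_eq, nhdsWithin_univ]
      refine Tendsto.prodMk ?_ tendsto_const_nhds
      exact tendsto_id.mono_left (nhdsWithin_mono _ Ioi_subset_Ici_self)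
    have h3 := h1.comp h2
    simpa [Function.comp_def] using h3

/-- Wiener-Ikehara, smoothed by a Fejér kernel. -/
theorem abs_smoothed_sum_sub_le {a : ℕ → ℝ} (h0 : a 0 = 0) (hpos : ∀ n, 0 ≤ a n) {c : ℝ}
    {G : ℂ → ℂ} (hG : ContinuousOn G {s | 1 ≤ s.re})
    (hsum : ∀ s : ℂ, 1 < s.re → LSeriesSummable (fun n => (a n : ℂ)) s)
    (hL : ∀ s : ℂ, 1 < s.re → LSeries (fun n => (a n : ℂ)) s = G s + c / (s - 1))
    {l κ : ℝ} (hl : 0 < l) (hκ : 0 < κ) :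
    ∃ Y : ℝ, ∀ y ≥ Y, ∀ᶠ δ in 𝓝[>] (0 : ℝ),
      |∑' n : ℕ, a n / (n : ℝ) ^ (1 + δ) * fejer l (y - Real.log n) -
        c * ∫ v in Ioi (0 : ℝ), Real.exp (-δ * v) * fejer l (y - v)| ≤ κ := by
  have hc := continuous_triangle l
  have h1 := (tendsto_integral_triangle_zero G hl).norm
  rw [norm_zero] at h1
  obtain ⟨Y, hY⟩ := eventually_atTop.1 (h1.eventually (gt_mem_nhds hκ))
  -- The boundary integral alone fixes Y; only the admissible range of δ depends on y.
  refine ⟨Y, fun y hy => ?_⟩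
  have h2 := (tendsto_integral_triangle_boundary hG hl y).norm.eventually (gt_mem_nhds (hY y hy))
  filter_upwards [h2, self_mem_nhdsWithin] with δ hδ hδ0
  rw [mem_Ioi] at hδ0
  have h3 := (hasSum_fejer h0 hpos hl y (σ := 1 + δ) (hsum _ (by simpa using hδ0))).tsum_eq
  have h4 : ∀ τ : ℝ, (triangle l τ : ℂ) * cexp (τ * y * I) *
      LSeries (fun n => (a n : ℂ)) ((1 + δ : ℝ) + τ * I) =
      (triangle l τ : ℂ) * cexp (τ * y * I) * G ((1 + δ : ℝ) + τ * I) +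
        c * ((triangle l τ : ℂ) * cexp (τ * y * I) * (1 / (δ + τ * I))) := by
    intro τ
    rw [hL _ (by simpa using hδ0)]
    have : ((1 + δ : ℝ) : ℂ) + τ * I - 1 = δ + τ * I := by push_cast; ring
    rw [this]
    ring
  simp_rw [h4] at h3
  have hne : ∀ τ : ℝ, (δ : ℂ) + τ * I ≠ 0 := fun τ h => hδ0.ne' (by simpa using congrArg re h)
  have hG' := continuous_comp_line hG (σ := 1 + δ) (by linarith)
  rw [intervalIntegral.integral_add, intervalIntegral.integral_const_mul,
    integral_triangle_div hl hδ0, ← ofReal_tsum, ← ofReal_mul] at h3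
  · have h5 := sub_eq_iff_eq_add.2 h3
    rw [← ofReal_sub] at h5
    rw [← h5, norm_real] at hδ
    exact hδ.le
  · exact Continuous.intervalIntegrable (Continuous.mul (by fun_prop) hG') _ _
  · refine Continuous.intervalIntegrable ?_ _ _
    exact continuous_const.mul (Continuous.mul (by fun_prop)
      (continuous_const.div (by fun_prop) hne))

end Furedi

namespace Furedi

/-! ### Prime powers in multiplicative intervals. -/

open MeasureTheory Set Complex

theorem integrable_fejer_sub {l : ℝ} (hl : 0 < l) (y : ℝ) :
    Integrable fun v => fejer l (y - v) :=
  (integrable_fejer hl).comp_sub_left y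

theorem integrableOn_exp_mul_fejer {l δ : ℝ} (hl : 0 < l) (hδ : 0 ≤ δ) (y : ℝ) :
    IntegrableOn (fun v => Real.exp (-δ * v) * fejer l (y - v)) (Ioi 0) := by
  have hf := continuous_fejer l
  refine (integrable_fejer_sub hl y).integrableOn.mono'
    (Continuous.aestronglyMeasurable (by fun_prop)) ?_
  filter_upwards [ae_restrict_mem measurableSet_Ioi] with v hv
  rw [Real.norm_of_nonneg (mul_nonneg (Real.exp_pos _).le (fejer_nonneg hl _))]
  exact mul_le_of_le_one_left (fejer_nonneg hl _)
    (Real.exp_le_one_iff.2 (by nlinarith [mul_nonneg hδ (mem_Ioi.1 hv).le]))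

theorem integral_exp_mul_fejer_le {l δ : ℝ} (hl : 0 < l) (hδ : 0 ≤ δ) (y : ℝ) :
    ∫ v in Ioi (0 : ℝ), Real.exp (-δ * v) * fejer l (y - v) ≤ ∫ u, fejer l u := by
  calc ∫ v in Ioi (0 : ℝ), Real.exp (-δ * v) * fejer l (y - v)
      ≤ ∫ v in Ioi (0 : ℝ), fejer l (y - v) := by
        refine setIntegral_mono_on (integrableOn_exp_mul_fejer hl hδ y)
          (integrable_fejer_sub hl y).integrableOn measurableSet_Ioi fun v hv => ?_
        exact mul_le_of_le_one_left (fejer_nonneg hl _)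
          (Real.exp_le_one_iff.2 (by nlinarith [mul_nonneg hδ (mem_Ioi.1 hv).le]))
    _ ≤ ∫ v, fejer l (y - v) :=
        setIntegral_le_integral (integrable_fejer_sub hl y)
          (ae_of_all _ fun v => fejer_nonneg hl _)
    _ = ∫ u, fejer l u := integral_sub_left_eq_self _ _ _

/-- The window (y - 1/l, y] has length 1/l, and on it the kernel is at least l/4. -/
theorem le_integral_exp_mul_fejer {l δ y : ℝ} (hl : 0 < l) (hδ : 0 ≤ δ) (hy : 1 / l ≤ y) :
    Real.exp (-δ * y) / 4 ≤
      ∫ v in Ioi (0 : ℝ), Real.exp (-δ * v) * fejer l (y - v) := by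
  have hint := integrableOn_exp_mul_fejer hl hδ y
  have hl' : 0 < 1 / l := by positivity
  have hsub : Ioc (y - 1 / l) y ⊆ Ioi 0 := fun v hv => lt_of_le_of_lt (by linarith) hv.1
  calc Real.exp (-δ * y) / 4 = ∫ v in Ioc (y - 1 / l) y, Real.exp (-δ * y) * (l / 4) := by
        rw [setIntegral_const, measureReal_def, Real.volume_Ioc, ENNReal.toReal_ofReal (by linarith),
          smul_eq_mul]
        field_simp
        ring
    _ ≤ ∫ v in Ioc (y - 1 / l) y, Real.exp (-δ * v) * fejer l (y - v) := by
        refine setIntegral_mono_on (integrableOn_const (by simp)) (hint.mono_set hsub)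
          measurableSet_Ioc fun v hv => ?_
        refine mul_le_mul (Real.exp_le_exp.2 ?_) (quarter_le_fejer hl ?_) (by positivity)
          (Real.exp_pos _).le
        · nlinarith [mul_le_mul_of_nonneg_left hv.2 hδ]
        · rw [abs_of_nonneg (by linarith [hv.2])]
          linarith [hv.1]
    _ ≤ _ := setIntegral_mono_set hint
        (ae_of_all _ fun v => mul_nonneg (Real.exp_pos _).le (fejer_nonneg hl _))
        hsub.eventuallyLE

/-- A nonnegative sequence whose Dirichlet series continues to `1 ≤ re s` apart from a simple pole
at `1` does not vanish on long multiplicative intervals. -/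
theorem exists_ne_zero_abs_log_sub_lt {a : ℕ → ℝ} (h0 : a 0 = 0) (hpos : ∀ n, 0 ≤ a n) {c : ℝ}
    (hc : 0 < c) {G : ℂ → ℂ} (hG : ContinuousOn G {s | 1 ≤ s.re})
    (hsum : ∀ s : ℂ, 1 < s.re → LSeriesSummable (fun n => (a n : ℂ)) s)
    (hL : ∀ s : ℂ, 1 < s.re → LSeries (fun n => (a n : ℂ)) s = G s + c / (s - 1))
    {η : ℝ} (hη : 0 < η) :
    ∃ Y : ℝ, ∀ y ≥ Y, ∃ n : ℕ, a n ≠ 0 ∧ |y - Real.log n| < η := by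
  set B := (1 + Real.pi / η) ^ 2 with hB
  set M := c * (∫ u, fejer 1 u) + 1 with hM
  have hB0 : 0 < B := by have := Real.pi_pos; positivity
  have hM0 : 0 < M := by
    have : 0 ≤ ∫ u, fejer 1 u := integral_nonneg fun u => fejer_nonneg one_pos u
    positivity
  -- With this l a gap bounds the narrow average by 2BM/l = c/16, while the pole forces it above c/8
  -- - c/32.
  set l := 32 * B * M / c with hl
  have hl0 : 0 < l := by positivity
  obtain ⟨Y₁, hY₁⟩ := abs_smoothed_sum_sub_le h0 hpos hG hsum hL hl0 (κ := c / 32) (by positivity)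
  obtain ⟨Y₂, hY₂⟩ := abs_smoothed_sum_sub_le h0 hpos hG hsum hL one_pos one_pos
  refine ⟨max (max Y₁ Y₂) (1 / l), fun y hy => ?_⟩
  have hy1 : Y₁ ≤ y := (le_max_left _ _).trans ((le_max_left _ _).trans hy)
  have hy2 : Y₂ ≤ y := (le_max_right _ _).trans ((le_max_left _ _).trans hy)
  have hy3 : 1 / l ≤ y := (le_max_right _ _).trans hy
  -- In a gap every nonzero term lies at distance at least η from y, where the narrow kernel is
  -- dominated by wide ones at y and y + π. The averages of these are at most M, whatever l is.
  by_contra! hgap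
  have hexp : ∀ᶠ δ in 𝓝[>] (0 : ℝ), 1 / 2 < Real.exp (-δ * y) := by
    have : Tendsto (fun δ : ℝ => Real.exp (-δ * y)) (𝓝[>] 0) (𝓝 (Real.exp (-0 * y))) :=
      ((Continuous.tendsto (by fun_prop) 0).mono_left nhdsWithin_le_nhds)
    refine this.eventually (lt_mem_nhds ?_)
    rw [neg_zero, zero_mul, Real.exp_zero]
    norm_num
  obtain ⟨δ, hδ1, hδ2, hδ3, hδ4, hδ0⟩ := ((hY₁ y hy1).and ((hY₂ y hy2).and
    ((hY₂ (y + Real.pi) (by linarith [Real.pi_pos])).and (hexp.and self_mem_nhdsWithin)))).exists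
  let w : ℕ → ℝ := fun n => a n / (n : ℝ) ^ (1 + δ)
  have hw : ∀ n, 0 ≤ w n := fun n => div_nonneg (hpos n) (by positivity)
  have hws : Summable w := summable_div_rpow h0 hpos (hsum _ (by simpa using hδ0))
  have hsf : ∀ l > 0, ∀ y, Summable fun n : ℕ => w n * fejer l (y - Real.log n) := fun l hl y =>
    (hws.mul_right l).of_nonneg_of_le (fun n => mul_nonneg (hw n) (fejer_nonneg hl _))
      fun n => mul_le_mul_of_nonneg_left (fejer_le hl _) (hw n)
  have hS : ∀ y, |∑' n : ℕ, w n * fejer 1 (y - Real.log n) -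
      c * ∫ v in Ioi (0 : ℝ), Real.exp (-δ * v) * fejer 1 (y - v)| ≤ 1 →
      ∑' n : ℕ, w n * fejer 1 (y - Real.log n) ≤ M := by
    intro y h
    have h1 := (abs_le.1 h).2
    have h2 := mul_le_mul_of_nonneg_left (integral_exp_mul_fejer_le one_pos hδ0.le y) hc.le
    linarith
  have hupper : ∑' n : ℕ, w n * fejer l (y - Real.log n) ≤ B / l * (M + M) := by
    calc ∑' n : ℕ, w n * fejer l (y - Real.log n)
        ≤ ∑' n : ℕ, B / l * (w n * fejer 1 (y - Real.log n) +
            w n * fejer 1 (y + Real.pi - Real.log n)) := by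
          refine (hsf l hl0 y).tsum_le_tsum (fun n => ?_)
            (((hsf 1 one_pos y).add (hsf 1 one_pos _)).mul_left _)
          by_cases hn : a n = 0
          · simp [w, hn]
          · have h1 := mul_le_mul_of_nonneg_left
              (fejer_le_translates hl0 hη (hgap n hn)) (hw n)
            rw [show y - Real.log n + Real.pi = y + Real.pi - Real.log n by ring] at h1
            refine h1.trans (le_of_eq ?_)
            ring
      _ = B / l * (∑' n : ℕ, w n * fejer 1 (y - Real.log n) +
            ∑' n : ℕ, w n * fejer 1 (y + Real.pi - Real.log n)) := by
          rw [tsum_mul_left, (hsf 1 one_pos y).tsum_add (hsf 1 one_pos _)]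
      _ ≤ B / l * (M + M) := by
          gcongr
          · exact hS y hδ2
          · exact hS _ hδ3
  have hlower := (abs_le.1 hδ1).1
  have h1 := mul_le_mul_of_nonneg_left (le_integral_exp_mul_fejer hl0 hδ0.le hy3) hc.le
  have h2 : B / l * (M + M) = c / 16 := by
    rw [hl]
    field_simp
    ring
  rw [h2] at hupper
  have h3 : c * (1 / 2) < c * Real.exp (-δ * y) := mul_lt_mul_of_pos_left hδ4 hc
  change -(c / 32) ≤ ∑' n : ℕ, w n * fejer l (y - Real.log n) - _ at hlower
  linarith

/-- Prime powers congruent to `1` modulo `t` occur in all long multiplicative intervals. -/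
theorem exists_isPrimePow_mem_Icc (t : ℕ) (ht : 1 ≤ t) {η : ℝ} (hη : 1 < η) :
    ∃ X : ℝ, ∀ x ≥ X, ∃ q : ℕ, IsPrimePow q ∧ t ∣ q - 1 ∧ x / η ≤ q ∧ (q : ℝ) ≤ x := by
  have : NeZero t := ⟨by omega⟩
  have hu : IsUnit (1 : ZMod t) := isUnit_one
  have hc : 0 < ((t.totient : ℝ))⁻¹ := by
    have : 0 < t.totient := Nat.totient_pos.2 ht
    positivity
  have hη' : 0 < Real.log η / 2 := half_pos (Real.log_pos hη)
  obtain ⟨Y, hY⟩ := exists_ne_zero_abs_log_sub_lt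
    (a := ArithmeticFunction.vonMangoldt.residueClass (1 : ZMod t))
    (ArithmeticFunction.vonMangoldt.residueClass_apply_zero _)
    (ArithmeticFunction.vonMangoldt.residueClass_nonneg _) hc
    (ArithmeticFunction.vonMangoldt.continuousOn_LFunctionResidueClassAux (1 : ZMod t))
    (fun s hs => LSeriesSummable_of_abscissaOfAbsConv_lt_re
      ((ArithmeticFunction.vonMangoldt.abscissaOfAbsConv_residueClass_le_one _).trans_lt
        (by exact_mod_cast hs)))
    (fun s hs => by
      rw [ArithmeticFunction.vonMangoldt.eqOn_LFunctionResidueClassAux hu hs]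
      push_cast
      ring) hη'
  refine ⟨Real.exp (Y + Real.log η / 2), fun x hx => ?_⟩
  have hx0 : 0 < x := (Real.exp_pos _).trans_le hx
  have hlx := (Real.le_log_iff_exp_le hx0).2 hx
  -- A window of radius (log η)/2 about log x - (log η)/2 is the interval from log (x/η) to log x.
  obtain ⟨q, hq, hqy⟩ := hY (Real.log x - Real.log η / 2) (by linarith)
  have hmem := Set.mem_of_indicator_ne_zero hq
  have hval : ArithmeticFunction.vonMangoldt q ≠ 0 := by
    rwa [ArithmeticFunction.vonMangoldt.residueClass, Set.indicator_of_mem hmem] at hq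
  have hpp := ArithmeticFunction.vonMangoldt_ne_zero_iff.1 hval
  have hq0 : (0 : ℝ) < q := Nat.cast_pos.2 hpp.pos
  refine ⟨q, hpp, ?_, ?_, ?_⟩
  · refine (Nat.modEq_iff_dvd' hpp.one_lt.le).1 ?_
    rw [← ZMod.natCast_eq_natCast_iff]
    have : (q : ZMod t) = 1 := hmem
    rw [this, Nat.cast_one]
  · rw [← Real.log_le_log_iff (by positivity) hq0, Real.log_div hx0.ne' (by positivity)]
    linarith [(abs_lt.1 hqy).2]
  · rw [← Real.log_le_log_iff hq0 hx0]
    linarith [(abs_lt.1 hqy).1]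

end Furedi

namespace Furedi

/-! ### Vertices, edges and extremal numbers. -/

section Count

variable {F : Type*} [Field F] [Finite F] (H : Subgroup Fˣ)

instance : Finite (Vertex H) := inferInstanceAs (Finite (Quotient (pairSetoid H)))

/-- H acts freely on nonzero pairs, so every class has |H| elements. -/
theorem card_vertex_mul_card :
    Nat.card (Vertex H) * Nat.card H = Nat.card F ^ 2 - 1 := by
  classical
  have hfib : ∀ v : Vertex H,
      Nat.card {p : {p : F × F // p ≠ 0} // Quotient.mk (pairSetoid H) p = v} = Nat.card H := by
    intro v
    obtain ⟨⟨⟨a, b⟩, h0⟩, rfl⟩ := Quotient.exists_rep v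
    have hne : ∀ h : Fˣ, ((h : F) * a, (h : F) * b) ≠ (0 : F × F) := by
      intro h hh
      rw [Prod.mk_eq_zero] at hh
      exact h0 (Prod.mk_eq_zero.2 ⟨(h.mul_right_eq_zero).1 hh.1, (h.mul_right_eq_zero).1 hh.2⟩)
    let f : H → {p : {p : F × F // p ≠ 0} //
        Quotient.mk (pairSetoid H) p = Quotient.mk (pairSetoid H) ⟨(a, b), h0⟩} :=
      fun h => ⟨⟨((h : Fˣ) * a, (h : Fˣ) * b), hne h⟩, Quotient.sound ⟨h, h.2, rfl, rfl⟩⟩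
    refine (Nat.card_congr (Equiv.ofBijective f ⟨?_, ?_⟩)).symm
    · rintro ⟨h, hh⟩ ⟨k, hk⟩ e
      have e' : ((h : F) * a, (h : F) * b) = ((k : F) * a, (k : F) * b) :=
        congrArg (fun z => z.1.1) e
      rw [Prod.mk.injEq] at e'
      refine Subtype.ext (Units.ext ?_)
      by_cases ha : a = 0
      · have hb : b ≠ 0 := fun hb => h0 (Prod.mk_eq_zero.2 ⟨ha, hb⟩)
        exact mul_right_cancel₀ hb e'.2
      · exact mul_right_cancel₀ ha e'.1
    · rintro ⟨⟨⟨x, y⟩, hxy⟩, e⟩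
      obtain ⟨h, hh, e1, e2⟩ := Quotient.exact e
      exact ⟨⟨h, hh⟩, Subtype.ext (Subtype.ext (Prod.ext e1.symm e2.symm))⟩
  have h1 := Nat.card_congr (Equiv.sigmaFiberEquiv (Quotient.mk (pairSetoid H)))
  have := Fintype.ofFinite (Vertex H)
  have h2 : Nat.card {p : F × F // p ≠ 0} = Nat.card F ^ 2 - 1 := by
    have := Fintype.ofFinite F
    rw [Nat.card_eq_fintype_card, Fintype.card_subtype_compl, Fintype.card_prod,
      Fintype.card_subtype_eq, Nat.card_eq_fintype_card, sq]
  rw [← h2, ← h1]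
  change _ = Nat.card (Σ v : Vertex H, {p // Quotient.mk (pairSetoid H) p = v})
  rw [Nat.card_sigma, Finset.sum_congr rfl fun v _ => hfib v, Finset.sum_const, Finset.card_univ,
    smul_eq_mul, Nat.card_eq_fintype_card]

/-- The line a x + b y = 1 has |F| points, and they are pairwise inequivalent because a factor h
between two of them satisfies 1 = h · 1. At most one of their classes is v itself. -/
theorem card_sub_one_le_card_neighborSet (v : Vertex H) :
    Nat.card F - 1 ≤ Nat.card ((graph H).neighborSet v) := by
  classical
  obtain ⟨⟨⟨a, b⟩, h0⟩, rfl⟩ := Quotient.exists_rep v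
  obtain ⟨x₀, y₀, e₀⟩ : ∃ x y : F, a * x + b * y = 1 := by
    by_cases ha : a = 0
    · have hb : b ≠ 0 := fun hb => h0 (Prod.mk_eq_zero.2 ⟨ha, hb⟩)
      exact ⟨0, b⁻¹, by simp [hb]⟩
    · exact ⟨a⁻¹, 0, by simp [ha]⟩
  have hline : ∀ z, a * (x₀ - z * b) + b * (y₀ + z * a) = 1 := fun z => by
    rw [← e₀]; ring
  have hne : ∀ z, (x₀ - z * b, y₀ + z * a) ≠ (0 : F × F) := by
    intro z h
    rw [Prod.mk_eq_zero] at h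
    have := hline z
    rw [h.1, h.2] at this
    simp at this
  let w : F → Vertex H := fun z =>
    Quotient.mk (pairSetoid H) ⟨(x₀ - z * b, y₀ + z * a), hne z⟩
  have hw : Function.Injective w := by
    intro z z' e
    obtain ⟨h, -, e1, e2⟩ := Quotient.exact e
    simp only at e1 e2
    have h1 : (h : F) = 1 := by
      have h2 := hline z
      rw [e1, e2] at h2
      linear_combination h2 - (h : F) * hline z'
    rw [h1, one_mul] at e1 e2
    by_cases ha : a = 0
    · have hb : b ≠ 0 := fun hb => h0 (Prod.mk_eq_zero.2 ⟨ha, hb⟩)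
      exact mul_right_cancel₀ hb (by linear_combination -e1)
    · exact mul_right_cancel₀ ha (by linear_combination e2)
  have hsub : Set.range w \ {Quotient.mk (pairSetoid H) ⟨(a, b), h0⟩} ⊆
      (graph H).neighborSet (Quotient.mk (pairSetoid H) ⟨(a, b), h0⟩) := by
    rintro _ ⟨⟨z, rfl⟩, hz⟩
    exact ⟨fun h => hz h.symm, 1, H.one_mem, by simpa using hline z⟩
  have h1 := Set.ncard_le_ncard hsub (Set.toFinite _)
  have h2 : ∀ u : Vertex H, Nat.card F - 1 ≤ (Set.range w \ {u}).ncard := fun u => by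
    have h3 := Set.le_ncard_sdiff {u} (Set.range w)
    rwa [Set.ncard_singleton, Set.ncard_range_of_injective hw] at h3
  exact (h2 _).trans h1

theorem card_mul_le_two_mul_card_edgeFinset [Fintype (Vertex H)] [DecidableRel (graph H).Adj] :
    Nat.card (Vertex H) * (Nat.card F - 1) ≤ 2 * (graph H).edgeFinset.card := by
  rw [← SimpleGraph.sum_degrees_eq_twice_card_edges, Nat.card_eq_fintype_card, ← smul_eq_mul,
    ← Finset.card_univ, ← Finset.sum_const]
  refine Finset.sum_le_sum fun v _ => ?_
  rw [← SimpleGraph.card_neighborSet_eq_degree, ← Nat.card_eq_fintype_card]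
  exact card_sub_one_le_card_neighborSet H v

end Count

theorem exists_subgroup_card_eq {G : Type*} [Group G] [Finite G] [IsCyclic G] {s : ℕ}
    (hs : s ∣ Nat.card G) : ∃ H : Subgroup G, Nat.card H = s := by
  obtain ⟨g, hg⟩ := IsCyclic.exists_ofOrder_eq_natCard (α := G)
  obtain ⟨d, hd⟩ := hs
  have hpos : 0 < Nat.card G := Nat.card_pos
  have hd0 : d ≠ 0 := by rintro rfl; omega
  refine ⟨Subgroup.zpowers (g ^ d), ?_⟩
  rw [Nat.card_zpowers, orderOf_pow_of_dvd hd0 (by rw [hg, hd]; exact dvd_mul_left _ _), hg, hd,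
    Nat.mul_div_cancel _ (Nat.pos_of_ne_zero hd0)]

/-- Pad a graph with isolated vertices: since K has none, a copy of K in the padded graph already
lies in the original. -/
theorem extremalNumber_mono {W : Type*} (K : SimpleGraph W) (hK : ∀ w, ∃ w', K.Adj w w')
    {m n : ℕ} (hmn : m ≤ n) :
    SimpleGraph.extremalNumber m K ≤ SimpleGraph.extremalNumber n K := by
  classical
  conv_lhs => rw [← Fintype.card_fin m]
  rw [SimpleGraph.extremalNumber_le_iff]
  intro G _ hG
  let e := Fin.castLEEmb hmn
  have h1 : K.Free (G.map e) := by
    rintro ⟨f⟩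
    have hex : ∀ w, ∃ u, e u = f w := by
      intro w
      obtain ⟨w', hw⟩ := hK w
      obtain ⟨u, u', -, hu, -⟩ := (SimpleGraph.map_adj _ _ _ _).1 (f.toHom.map_adj hw)
      exact ⟨u, hu⟩
    choose g hg using hex
    refine hG ⟨⟨⟨g, fun {w w'} hw => ?_⟩, fun w w' h => f.injective ?_⟩⟩
    · obtain ⟨u, u', hadj, hu, hu'⟩ := (SimpleGraph.map_adj _ _ _ _).1 (f.toHom.map_adj hw)
      have h1 : g w = u := e.injective ((hg w).trans hu.symm)
      have h2 : g w' = u' := e.injective ((hg w').trans hu'.symm)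
      rwa [h1, h2]
    · exact (hg w).symm.trans ((congrArg e h).trans (hg w'))
  have h2 := SimpleGraph.card_edgeFinset_le_extremalNumber h1
  rw [Fintype.card_fin] at h2
  refine le_trans (le_of_eq ?_) h2
  convert! (SimpleGraph.card_edgeFinset_map e G).symm

/-- The edges of the graph `G(q ^ (m + 1), t (q ^ m + ⋯ + 1))` bound the extremal number. -/
theorem exists_le_extremalNumber {q m t : ℕ} (hq : IsPrimePow q) (ht : 0 < t) (htq : t ∣ q - 1) :
    ∃ N : ℕ, t * N = (q ^ (m + 1) + 1) * (q - 1) ∧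
      N * (q ^ (m + 1) - 1) ≤ 2 * SimpleGraph.extremalNumber N (completeBipartiteGraph
        (Fin (m + 2)) (Fin (t ^ (m + 1) * (m + 1).factorial + 1))) := by
  classical
  obtain ⟨p, k, hp, hk, hpk⟩ := (isPrimePow_nat_iff q).1 hq
  have := Fact.mk hp
  let F := GaloisField p (k * (m + 1))
  have hF : Nat.card F = q ^ (m + 1) := by
    rw [GaloisField.card p _ (by positivity), pow_mul, hpk]
  have : Finite F := Nat.finite_of_card_ne_zero (by rw [hF]; exact (pow_pos hq.pos _).ne')
  have hgeom : (q - 1) * ∑ i ∈ Finset.range (m + 1), q ^ i = q ^ (m + 1) - 1 := by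
    have h1 := Nat.geomSum_eq hq.one_lt (m + 1)
    have h2 := Nat.sub_one_dvd_pow_sub_one q (m + 1)
    rw [h1, Nat.mul_div_cancel' h2]
  obtain ⟨H, hH⟩ := exists_subgroup_card_eq (G := Fˣ)
    (s := t * ∑ i ∈ Finset.range (m + 1), q ^ i) (by
      rw [Nat.card_units, hF, ← hgeom]
      exact Nat.mul_dvd_mul_right htq _)
  have := Fintype.ofFinite (Vertex H)
  refine ⟨Nat.card (Vertex H), ?_, ?_⟩
  · have h1 := card_vertex_mul_card H
    have hpos : 0 < ∑ i ∈ Finset.range (m + 1), q ^ i :=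
      Finset.sum_pos (fun i _ => pow_pos hq.pos i) (by simp)
    -- Both sides times the geometric sum equal Q² - 1 = (Q + 1)(Q - 1), where Q = q^(m+1).
    refine Nat.eq_of_mul_eq_mul_right hpos ?_
    rw [mul_assoc _ (q - 1), hgeom, ← Nat.sq_sub_sq, one_pow, ← hF, ← h1, hH]
    ring
  · rw [← hF, Nat.card_eq_fintype_card (α := Vertex H)]
    have h1 := card_mul_le_two_mul_card_edgeFinset H
    rw [Nat.card_eq_fintype_card (α := Vertex H)] at h1
    exact h1.trans (Nat.mul_le_mul_left 2
      (SimpleGraph.card_edgeFinset_le_extremalNumber (graph_free hq ht hF hH)))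

end Furedi

/-! ### The asymptotic lower bound. -/

namespace Furedi

theorem exists_adj_completeBipartiteGraph {α β : Type*} [Nonempty α] [Nonempty β] (w : α ⊕ β) :
    ∃ w', (completeBipartiteGraph α β).Adj w w' := by
  rcases w with a | b
  · exact ⟨Sum.inr (Classical.arbitrary β), by simp⟩
  · exact ⟨Sum.inl (Classical.arbitrary α), by simp⟩

/-- The graph fits on n vertices, as (q^(m+1) + 1)(q - 1) ≤ q^(m+2). Twice t times its edge number
is at least (q^(2m+2) - 1)(q - 1) ≥ q^(2m+1)(q - 1)². -/
theorem pow_le_two_mul_extremalNumber {q m t n : ℕ} (hq : IsPrimePow q) (ht : 0 < t)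
    (htq : t ∣ q - 1) (hn : q ^ (m + 2) ≤ t * n) :
    (q : ℝ) ^ (2 * m + 3) * (1 - 1 / q) ^ 2 ≤
      2 * t * (SimpleGraph.extremalNumber n (completeBipartiteGraph
        (Fin (m + 2)) (Fin (t ^ (m + 1) * (m + 1).factorial + 1))) : ℝ) := by
  obtain ⟨N, hN, hex⟩ := exists_le_extremalNumber (m := m) hq ht htq
  have hq1 : 1 ≤ q := hq.one_lt.le
  have hNn : N ≤ n := by
    refine Nat.le_of_mul_le_mul_left (le_trans ?_ hn) ht
    rw [hN]
    zify [hq1]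
    have h1 : (q : ℤ) ≤ (q : ℤ) ^ (m + 1) := by
      exact_mod_cast Nat.le_self_pow (Nat.succ_ne_zero m) q
    rw [pow_succ _ (m + 1)]
    linarith
  have hmono := extremalNumber_mono _ (exists_adj_completeBipartiteGraph (α := Fin (m + 2))
    (β := Fin (t ^ (m + 1) * (m + 1).factorial + 1))) hNn
  have h1 : (q ^ (m + 1) + 1) * (q - 1) * (q ^ (m + 1) - 1) ≤
      2 * t * SimpleGraph.extremalNumber n (completeBipartiteGraph
        (Fin (m + 2)) (Fin (t ^ (m + 1) * (m + 1).factorial + 1))) := by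
    rw [← hN, mul_assoc, mul_comm 2 t, mul_assoc t 2]
    exact Nat.mul_le_mul_left t (hex.trans (Nat.mul_le_mul_left 2 hmono))
  have h2 : ((q : ℝ) ^ (m + 1) + 1) * (q - 1) * ((q : ℝ) ^ (m + 1) - 1) ≤
      2 * t * (SimpleGraph.extremalNumber n (completeBipartiteGraph
        (Fin (m + 2)) (Fin (t ^ (m + 1) * (m + 1).factorial + 1))) : ℝ) := by
    have h3 : (((q ^ (m + 1) + 1) * (q - 1) * (q ^ (m + 1) - 1) : ℕ) : ℝ) ≤ _ :=
      Nat.cast_le.2 h1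
    rw [Nat.cast_mul, Nat.cast_mul, Nat.cast_sub hq1, Nat.cast_sub (Nat.one_le_pow _ _ hq1)] at h3
    push_cast at h3
    exact h3
  refine le_trans ?_ h2
  have hqr : (1 : ℝ) ≤ q := by exact_mod_cast hq1
  have hq0 : (q : ℝ) ≠ 0 := by positivity
  have e1 : (q : ℝ) ^ (2 * m + 3) * (1 - 1 / q) ^ 2 = (q : ℝ) ^ (2 * m + 1) * (q - 1) * (q - 1) := by
    field_simp
    ring
  have e2 : ((q : ℝ) ^ (m + 1) + 1) * (q - 1) * ((q : ℝ) ^ (m + 1) - 1) =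
      ((q : ℝ) ^ (2 * m + 1) * q - 1) * (q - 1) := by ring
  rw [e1, e2]
  have h4 : 1 ≤ (q : ℝ) ^ (2 * m + 1) := one_le_pow₀ hqr
  exact mul_le_mul_of_nonneg_right (by linarith) (by linarith)

theorem eventually_pow_le_extremalNumber (m t : ℕ) (ht : 0 < t) {κ : ℝ} (hκ : 0 < κ)
    (hκ1 : κ < 1) :
    ∀ᶠ n : ℕ in atTop, (1 - κ) * (((t * n : ℕ) : ℝ) ^ (1 / ((m + 2 : ℕ) : ℝ))) ^ (2 * m + 3) ≤
      2 * t * (SimpleGraph.extremalNumber n (completeBipartiteGraph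
        (Fin (m + 2)) (Fin (t ^ (m + 1) * (m + 1).factorial + 1))) : ℝ) := by
  -- The loss is η^(2m+3) from q ≥ x/η and η² from (1 - 1/q)² ≥ 1/η².
  obtain ⟨η, hη1, hη⟩ : ∃ η : ℝ, 1 < η ∧ (1 - κ) * η ^ (2 * m + 5) ≤ 1 := by
    have h1 : Tendsto (fun η : ℝ => (1 - κ) * η ^ (2 * m + 5)) (𝓝[>] 1)
        (𝓝 ((1 - κ) * 1 ^ (2 * m + 5))) :=
      (Continuous.tendsto (by fun_prop) 1).mono_left nhdsWithin_le_nhds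
    have h2 := h1.eventually (gt_mem_nhds (show (1 - κ) * 1 ^ (2 * m + 5) < 1 by
      rw [one_pow]; linarith))
    obtain ⟨η, h3, h4⟩ := (h2.and self_mem_nhdsWithin).exists
    exact ⟨η, h4, h3.le⟩
  obtain ⟨X, hX⟩ := exists_isPrimePow_mem_Icc t ht hη1
  have htend : Tendsto (fun n : ℕ => ((t * n : ℕ) : ℝ) ^ (1 / ((m + 2 : ℕ) : ℝ))) atTop atTop := by
    refine (tendsto_rpow_atTop (by positivity)).comp (tendsto_natCast_atTop_atTop.comp ?_)
    exact tendsto_id.const_mul_atTop' ht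
  -- The second threshold gives q ≥ x/η ≥ η/(η - 1), that is 1 - 1/q ≥ 1/η.
  filter_upwards [htend.eventually_ge_atTop X,
    htend.eventually_ge_atTop (η * (η / (η - 1)))] with n hn1 hn2
  set x := ((t * n : ℕ) : ℝ) ^ (1 / ((m + 2 : ℕ) : ℝ)) with hx
  obtain ⟨q, hq, htq, hq1, hq2⟩ := hX x hn1
  have hη0 : 0 < η - 1 := by linarith
  have hx0 : 0 < x := lt_of_lt_of_le (by positivity) hn2
  have hq0 : (0 : ℝ) < q := Nat.cast_pos.2 hq.pos
  have hxpow : x ^ (m + 2) = ((t * n : ℕ) : ℝ) := by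
    rw [hx, ← Real.rpow_natCast, ← Real.rpow_mul (by positivity), one_div_mul_cancel (by positivity),
      Real.rpow_one]
  have hqn : q ^ (m + 2) ≤ t * n := by
    have : (q : ℝ) ^ (m + 2) ≤ ((t * n : ℕ) : ℝ) := by
      rw [← hxpow]
      gcongr
    exact_mod_cast this
  refine le_trans ?_ (pow_le_two_mul_extremalNumber hq ht htq hqn)
  have h1 : 1 / η ≤ 1 - 1 / (q : ℝ) := by
    have h2 : η / (η - 1) ≤ q := by
      refine le_trans ?_ hq1
      rw [le_div_iff₀ (by linarith), mul_comm]
      exact hn2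
    have h3 : 1 / (q : ℝ) ≤ (η - 1) / η := by
      rw [div_le_div_iff₀ hq0 (by linarith), one_mul, mul_comm]
      rwa [div_le_iff₀ hη0] at h2
    have h4 : (η - 1) / η = 1 - 1 / η := by field_simp
    linarith
  calc (1 - κ) * x ^ (2 * m + 3) ≤ (x / η) ^ (2 * m + 3) * (1 / η) ^ 2 := by
        rw [div_pow, one_div, inv_pow, ← div_eq_mul_inv, div_div, ← pow_add, le_div_iff₀ (by positivity),
          show 2 * m + 3 + 2 = 2 * m + 5 by ring, mul_right_comm]
        exact mul_le_of_le_one_left (by positivity) hη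
    _ ≤ (q : ℝ) ^ (2 * m + 3) * (1 - 1 / (q : ℝ)) ^ 2 := by
        have : 0 < 1 / η := by positivity
        gcongr

theorem two_mul_mul_main_term (m t n : ℕ) (ht : 0 < t) :
    2 * (t : ℝ) * (1 / 2 * (t : ℝ) ^ ((((m + 2 : ℕ) : ℝ) - 1) / ((m + 2 : ℕ) : ℝ)) *
      (n : ℝ) ^ (2 - 1 / ((m + 2 : ℕ) : ℝ))) =
      (((t * n : ℕ) : ℝ) ^ (1 / ((m + 2 : ℕ) : ℝ))) ^ (2 * m + 3) := by
  have hr : ((m + 2 : ℕ) : ℝ) ≠ 0 := by positivity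
  have ht0 : (0 : ℝ) < t := Nat.cast_pos.2 ht
  have e : 1 / ((m + 2 : ℕ) : ℝ) * ((2 * m + 3 : ℕ) : ℝ) = 2 - 1 / ((m + 2 : ℕ) : ℝ) := by
    field_simp
    push_cast
    ring
  have e2 : 2 - 1 / ((m + 2 : ℕ) : ℝ) = 1 + (((m + 2 : ℕ) : ℝ) - 1) / ((m + 2 : ℕ) : ℝ) := by
    field_simp
    ring
  rw [← Real.rpow_natCast (_ ^ _), ← Real.rpow_mul (by positivity), e, Nat.cast_mul,
    Real.mul_rpow (by positivity) (by positivity)]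
  conv_rhs => rw [e2, Real.rpow_add ht0, Real.rpow_one, ← e2]
  ring

end Furedi

theorem theorem7 (r t : ℕ) (hr : 2 ≤ r) (ht : 1 ≤ t) :
    (∀ q : ℕ, IsPrimePow q → t ∣ q - 1 →
      ∀ (F : Type*) [Field F] [Finite F] (H : Subgroup Fˣ),
        Nat.card F = q ^ (r - 1) →
        Nat.card H = t * ∑ i ∈ Finset.range (r - 1), q ^ i →
        (completeBipartiteGraph (Fin r) (Fin (t ^ (r - 1) * (r - 1).factorial + 1))).Free
          (Furedi.graph H)) ∧
    ∃ ε : ℕ → ℝ, Tendsto ε atTop (𝓝 0) ∧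
      ∀ n : ℕ,
        1 / 2 * (t : ℝ) ^ (((r : ℝ) - 1) / (r : ℝ)) * (n : ℝ) ^ (2 - 1 / (r : ℝ)) * (1 + ε n) ≤
          (SimpleGraph.extremalNumber n (completeBipartiteGraph (Fin r)
            (Fin (t ^ (r - 1) * (r - 1).factorial + 1))) : ℝ) := by
  obtain ⟨m, rfl⟩ : ∃ m, r = m + 2 := ⟨r - 2, by omega⟩
  rw [show m + 2 - 1 = m + 1 from rfl]
  refine ⟨fun q hq _ F _ _ H hF hH => Furedi.graph_free hq ht hF hH, ?_⟩
  set L : ℕ → ℝ := fun n => 1 / 2 * (t : ℝ) ^ ((((m + 2 : ℕ) : ℝ) - 1) / ((m + 2 : ℕ) : ℝ)) *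
    (n : ℝ) ^ (2 - 1 / ((m + 2 : ℕ) : ℝ)) with hL
  set ex : ℕ → ℝ := fun n => (SimpleGraph.extremalNumber n (completeBipartiteGraph
    (Fin (m + 2)) (Fin (t ^ (m + 1) * (m + 1).factorial + 1))) : ℝ) with hex
  have hex0 : ∀ n, 0 ≤ ex n := fun n => Nat.cast_nonneg _
  have ht0 : (0 : ℝ) < t := Nat.cast_pos.2 ht
  have hLpos : ∀ n, 0 < n → 0 < L n := fun n hn => by
    have : (0 : ℝ) < n := Nat.cast_pos.2 hn
    positivity
  -- Only a lower bound on ex/L is available, so the error is capped at 0 to make it tend to 0.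
  refine ⟨fun n => min 0 (ex n / L n - 1), ?_, fun n => ?_⟩
  · rw [Metric.tendsto_nhds]
    intro κ hκ
    have hκ' : 0 < min (κ / 2) (1 / 2) := by positivity
    filter_upwards [Furedi.eventually_pow_le_extremalNumber m t ht hκ'
      (lt_of_le_of_lt (min_le_right _ _) (by norm_num)), eventually_gt_atTop 0] with n hn hn0
    rw [← Furedi.two_mul_mul_main_term m t n ht, mul_left_comm] at hn
    have h1 : (1 - min (κ / 2) (1 / 2)) * L n ≤ ex n :=
      le_of_mul_le_mul_left hn (by positivity)
    have h2 := (le_div_iff₀ (hLpos n hn0)).2 h1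
    have h3 := min_le_left (κ / 2) (1 / 2)
    rw [Real.dist_eq, sub_zero, abs_of_nonpos (min_le_left _ _), neg_lt]
    exact lt_min (by linarith) (by linarith)
  · change L n * (1 + min 0 (ex n / L n - 1)) ≤ ex n
    -- At n = 0 the main term L vanishes, so the quotient defining the error plays no role.
    rcases Nat.eq_zero_or_pos n with rfl | hn
    · have h1 : (0 : ℝ) < 2 - 1 / ((m + 2 : ℕ) : ℝ) := by
        have : 1 / ((m + 2 : ℕ) : ℝ) ≤ 1 := by
          rw [div_le_one (by positivity)]
          exact_mod_cast (by omega : 1 ≤ m + 2)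
        linarith
      have h2 : L 0 = 0 := by
        simp only [hL, Nat.cast_zero, Real.zero_rpow h1.ne', mul_zero]
      rw [h2, zero_mul]
      exact hex0 0
    · have h1 : 1 + min 0 (ex n / L n - 1) ≤ ex n / L n := by
        linarith [min_le_right 0 (ex n / L n - 1)]
      calc L n * (1 + min 0 (ex n / L n - 1)) ≤ L n * (ex n / L n) :=
            mul_le_mul_of_nonneg_left h1 (hLpos n hn).le
        _ = ex n := mul_div_cancel₀ _ (hLpos n hn).ne'
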